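/- Let $p$ be a prime, let $\Omega=\mathbf{C}_p$ be the completion of an algebraic closure of $\mathbf{Q}_p$, with additive valuation $\operatorname{ord}$ normalized by $\operatorname{ord}(p)=1$, and let $\zeta_p\in\Omega$ be a primitive $p$-th root of unity. Let $w_1,\dots,w_n\in\mathbf{Z}^n$, let $J=(w_1,\dots,w_n)$ be the matrix with columns $w_i$, assume $(p,\det J)=1$ (so that $J$ is invertible over $\mathbf{R}$), and put $f=x^{w_1}+\cdots+x^{w_n}\in\mathbf{F}_p[x_1^{\pm1},\dots,x_n^{\pm1}]$. For $i\ge 1$ let $$S_i(f)=\sum_{x\in(\mathbf{F}_{p^i}^{\times})^n}\zeta_p^{\operatorname{Tr}_{\mathbf{F}_{p^i}/\mathbf{F}_p}(f(x))},\qquad L(f,t)=\exp\Big(\sum_{i\ge1}S_i(f)\frac{t^i}{i}\Big)\in\Omega[[t]].$$ The Newton polygon of a power series $\sum_i a_it^i$ over $\Omega$ is the lower convex hull in $\mathbf{R}^2$ of the points $(i,\operatorname{ord}a_i)$ with $a_i\ne0$. Let $\Delta$ be the convex hull of $0,w_1,\dots,w_n$, let $C(f)=\{\sum_i r_iw_i: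 r_i\in\mathbf{R}_{\ge0}\}$ and $M(f)=C(f)\cap\mathbf{Z}^n$. For $u=\sum_i r_iw_i$ put $w(u)=\sum_i r_i$. Let $M$ be any positive integer with $w(M(f))\subset\frac1M\mathbf{Z}$ (for instance $M=|\det J|$). For $l\in\mathbf{Z}$ and integers $k\ge0$ set $$W(l)=\#\{u\in M(f): w(u)=l/M\},\qquad H(k)=\sum_{l=0}^n(-1)^l\binom nl W(k-lM).$$ The Hodge polygon $HP(\Delta)$ is the convex polygon in $\mathbf{R}^2$ with vertices $(0,0)$ and $\big(\sum_{k=0}^mH(k),\ \frac1M\sum_{k=0}^mkH(k)\big)$, $m\ge0$. Let $S(\Delta)=\{\sum_i r_iw_i\in M(f): 0\le r_i<1 \text{ for all } i\}$, and for $u=\sum_i r_iw_i\in S(\Delta)$ let $p.u=\sum_i\{pr_i\}w_i$, where $\{\cdot\}$ denotes the fractional part. Then the Newton polygon of $L(f,t)^{(-1)^{n-1}}$ coincides with $HP(\Delta)$ if and only if $S(\Delta)$ is $p$-stable under the weight function, i.e. $w(p.u)=w(u)$ for every $u\in S(\Delta)$. -/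

import Mathlib

noncomputable section

namespace DiagExpSum

/-! ### Exponential sums and L-functions of Laurent polynomials over `𝔽_p` -/

/-- The value `f(x)` of a Laurent polynomial `f = ∑ a_w x^w` over a field `k`
(with exponents `w ∈ ℤⁿ`) at a point `x` of the torus `(Kˣ)ⁿ`, for an extension `K` of `k`. -/
def evalTorus {k K : Type*} [Field k] [Field K] [Algebra k K] {n : ℕ}
    (f : AddMonoidAlgebra k (Fin n → ℤ)) (x : Fin n → Kˣ) : K :=
  f.coeff.sum fun w a => algebraMap k K a * ∏ j, ((x j ^ w j : Kˣ) : K)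

/-- The exponential sum `S_i(f) = ∑_{x ∈ 𝕋ⁿ(𝔽_{p^i})} ζ ^ Tr(f(x))`, the trace being taken from
`𝔽_{p^i}` to `𝔽_p` (a finite sum, since the torus has finitely many points). -/
def expSum (p : ℕ) [Fact p.Prime] {Ω : Type*} [Field Ω] (ζ : Ω) {n : ℕ}
    (f : AddMonoidAlgebra (ZMod p) (Fin n → ℤ)) (i : ℕ) : Ω :=
  ∑ᶠ x : Fin n → (GaloisField p i)ˣ,
    ζ ^ (Algebra.trace (ZMod p) (GaloisField p i) (evalTorus f x)).val

/-- The L-function `L(f, t) = exp (∑_{i ≥ 1} S_i(f) t^i / i)`, as a formal power series. -/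
def LFunction (p : ℕ) [Fact p.Prime] {Ω : Type*} [Field Ω] [CharZero Ω] (ζ : Ω) {n : ℕ}
    (f : AddMonoidAlgebra (ZMod p) (Fin n → ℤ)) : PowerSeries Ω :=
  (PowerSeries.exp Ω).subst
    (PowerSeries.mk fun i => if i = 0 then (0 : Ω) else expSum p ζ f i / (i : Ω))

/-- The power series `L(f, t) ^ ((-1) ^ (n - 1))`: it is `L(f, t)` for odd `n` and the inverse
power series for even `n`. -/
def LFunctionSigned (p : ℕ) [Fact p.Prime] {Ω : Type*} [Field Ω] [CharZero Ω] (ζ : Ω) {n : ℕ}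
    (f : AddMonoidAlgebra (ZMod p) (Fin n → ℤ)) : PowerSeries Ω :=
  if Odd n then LFunction p ζ f else (LFunction p ζ f)⁻¹

/-- The diagonal Laurent polynomial `x^{w_1} + ⋯ + x^{w_n}` over `𝔽_p`. -/
def diagPoly (p : ℕ) {n : ℕ} (w : Fin n → Fin n → ℤ) :
    AddMonoidAlgebra (ZMod p) (Fin n → ℤ) :=
  ∑ i, AddMonoidAlgebra.single (w i) 1

/-! ### Polygons -/

/-- The lower convex hull of a set `P` of points of the plane: the lower boundary of the convex
hull of `P`. -/
def lowerHull (P : Set (ℝ × ℝ)) : Set (ℝ × ℝ) :=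
  {q | q ∈ convexHull ℝ P ∧ ∀ y : ℝ, (q.1, y) ∈ convexHull ℝ P → q.2 ≤ y}

/-- The additive valuation on `ℂ_p` with `ord p = 1`, i.e. `‖x‖ = p ^ (- ord x)`; it is only used
for `x ≠ 0`. -/
def ord (p : ℕ) [Fact p.Prime] (x : ℂ_[p]) : ℝ :=
  -Real.logb p ‖x‖

/-- The Newton polygon of `g = ∑ a_i t^i`: the lower convex hull of the points `(i, ord a_i)` with
`a_i ≠ 0`. -/
def newtonPolygon (p : ℕ) [Fact p.Prime] (g : PowerSeries ℂ_[p]) : Set (ℝ × ℝ) :=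
  lowerHull {q | ∃ i : ℕ, PowerSeries.coeff i g ≠ 0 ∧
    q = ((i : ℝ), ord p (PowerSeries.coeff i g))}

/-! ### The cone, the weight and the Hodge polygon -/

variable {n : ℕ}

/-- The matrix `J = (w_1, …, w_n)` with columns `w_i`. -/
def expMatrix (w : Fin n → Fin n → ℤ) : Matrix (Fin n) (Fin n) ℤ :=
  Matrix.of fun j i => w i j

/-- The vector `w_i` in `ℝⁿ`. -/
def realExp (w : Fin n → Fin n → ℤ) (i : Fin n) : Fin n → ℝ :=
  fun j => (w i j : ℝ)

/-- The coordinates `r = J⁻¹ v` of `v`: for invertible `J`, the unique `r` such that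
`v = r_1 w_1 + ⋯ + r_n w_n`. -/
def coords (w : Fin n → Fin n → ℤ) (v : Fin n → ℝ) : Fin n → ℝ :=
  Matrix.mulVec ((expMatrix w).map (Int.cast : ℤ → ℝ))⁻¹ v

/-- The weight `r_1 + ⋯ + r_n` of `v = r_1 w_1 + ⋯ + r_n w_n`. -/
def weight (w : Fin n → Fin n → ℤ) (v : Fin n → ℝ) : ℝ :=
  ∑ i, coords w v i

/-- The convex cone `C(f)` generated by `w_1, …, w_n`. -/
def cone (w : Fin n → Fin n → ℤ) : Set (Fin n → ℝ) :=
  {v | ∃ r : Fin n → ℝ, (∀ i, 0 ≤ r i) ∧ v = ∑ i, r i • realExp w i}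

/-- `M(f) = C(f) ∩ ℤⁿ`. -/
def coneLattice (w : Fin n → Fin n → ℤ) : Set (Fin n → ℝ) :=
  cone w ∩ {v | ∃ u : Fin n → ℤ, v = fun j => (u j : ℝ)}

/-- `S(Δ)`: the elements `r_1 w_1 + ⋯ + r_n w_n` of `M(f)` with all `0 ≤ r_i < 1`. -/
def fundDomain (w : Fin n → Fin n → ℤ) : Set (Fin n → ℝ) :=
  {v | v ∈ coneLattice w ∧ ∀ i, 0 ≤ coords w v i ∧ coords w v i < 1}

/-- `p.u = {p r_1} w_1 + ⋯ + {p r_n} w_n` for `u = r_1 w_1 + ⋯ + r_n w_n`. -/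
def pAct (p : ℕ) (w : Fin n → Fin n → ℤ) (v : Fin n → ℝ) : Fin n → ℝ :=
  ∑ i, Int.fract ((p : ℝ) * coords w v i) • realExp w i

/-- `S(Δ)` is `p`-stable under the weight function. -/
def IsPStable (p : ℕ) (w : Fin n → Fin n → ℤ) : Prop :=
  ∀ u ∈ fundDomain w, weight w u = weight w (pAct p w u)

/-- `M` is a common denominator of the weights: `M ≥ 1` and `w(M(f)) ⊆ (1/M) ℤ`. -/
def IsWeightDenominator (w : Fin n → Fin n → ℤ) (M : ℕ) : Prop :=
  0 < M ∧ ∀ u ∈ coneLattice w, ∃ z : ℤ, weight w u = (z : ℝ) / (M : ℝ)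

/-- `W(l)`, the number of `u ∈ M(f)` of weight `l / M` (which is `0` for `l < 0`). -/
def weightCount (w : Fin n → Fin n → ℤ) (M : ℕ) (l : ℤ) : ℕ :=
  Set.ncard {u | u ∈ coneLattice w ∧ weight w u = (l : ℝ) / (M : ℝ)}

/-- `H(k) = ∑_{l=0}^n (-1)^l (n choose l) W(k - l M)`. -/
def hodgeNumber (w : Fin n → Fin n → ℤ) (M : ℕ) (k : ℕ) : ℤ :=
  ∑ l ∈ Finset.range (n + 1),
    (-1) ^ l * (n.choose l : ℤ) * (weightCount w M ((k : ℤ) - (l : ℤ) * (M : ℤ)) : ℤ)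

/-- The Hodge polygon `HP(Δ)`: the convex polygon with vertices `(0, 0)` and
`(∑_{k ≤ m} H(k), (1/M) ∑_{k ≤ m} k H(k))` for `m ≥ 0`. -/
def hodgePolygon (w : Fin n → Fin n → ℤ) (M : ℕ) : Set (ℝ × ℝ) :=
  lowerHull ({(0, 0)} ∪ {q | ∃ m : ℕ,
    q = (∑ k ∈ Finset.range (m + 1), (hodgeNumber w M k : ℝ),
      (1 / (M : ℝ)) * ∑ k ∈ Finset.range (m + 1), (k : ℝ) * (hodgeNumber w M k : ℝ))})

end DiagExpSum

end

/-! The slopes of both polygons can be computed. Put `D = |det J|`. The coordinates of points of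
`S(Δ)` lie in `(1/D)ℤ ∩ [0, 1)`, and since `p` is prime to `D`, multiplication by `p` permutes
`S(Δ)`.

Newton side. Expanding the additive character in powers of a Teichmüller character and summing over
the torus turns `S_i(f)` into a sum, over the points of `S(Δ)` fixed by `p ^ i`, of products of `n`
Gauss sums (`expSum_eq_sum_gaussProd`). By the Hasse–Davenport relation (`hasseDavenport`), the
product of negated Gauss sums at level `d * m` is the `m`-th power of that at level `d`. The
exponential therefore collapses to a finite product of factors `1 - λ t ^ d`, one for each orbit of
length `d` (`LFunctionSigned_eq_orbitPoly`). Stickelberger's theorem (`norm_teichGauss`) makes `ord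
λ` the sum of the weights along the orbit. Each orbit thus contributes `d` slopes, all equal to the
average weight on it.

Hodge side. The generating series of `W` is `(∑ X ^ (M w(u))) / (1 - X ^ M) ^ n`, with `u` in
`S(Δ)`, so `H(k)` counts the points of `S(Δ)` of weight `k / M` (`hodgeNumber_eq`). The slopes are
the weights themselves.

Comparison. A lower hull of finitely many points is determined by its supporting lines
(`lowerHull_eq_iff`). For slope `s` the largest admissible intercept is `∑_o min(0, ∑_{u ∈ o} (w(u)
- s))` on the Newton side, with `o` running over the orbits, and `∑_u min(0, w(u) - s)` on the Hodge
side. The second never exceeds the first. Equality at the average weight of an orbit forces the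
weight to be constant on that orbit (`sum_min_orbits_eq_iff`). -/

noncomputable section

open Polynomial UniqueFactorizationMonoid
open scoped IntermediateField

namespace DiagExpSum

/-! ### Euler products over monic polynomials and the Hasse–Davenport relation -/

section HasseDavenport

variable {K : Type*} [Field K] [Fintype K] {R : Type*} [CommRing R]

/-- The finite set of monic polynomials of degree `k` over a finite field. -/
noncomputable def monicFinset (K : Type*) [Field K] [Fintype K] (k : ℕ) : Finset K[X] :=
  Set.Finite.toFinset (s := {f : K[X] | f.Monic ∧ f.natDegree = k}) (by
    refine Set.Finite.of_injOn (f := fun f (i : Fin (k + 1)) => f.coeff i)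
      (t := Set.univ) (fun _ _ => Set.mem_univ _) ?_ Set.finite_univ
    rintro f ⟨-, hf⟩ g ⟨-, hg⟩ h
    ext i
    by_cases hi : i < k + 1
    · exact congrFun h ⟨i, hi⟩
    · rw [coeff_eq_zero_of_natDegree_lt (by lia), coeff_eq_zero_of_natDegree_lt (by lia)])

lemma mem_monicFinset {k : ℕ} {f : K[X]} :
    f ∈ monicFinset K k ↔ f.Monic ∧ f.natDegree = k := by
  simp [monicFinset]

/-- The finite set of monic irreducible polynomials whose degree divides `k`. -/
noncomputable def irredFinset (K : Type*) [Field K] [Fintype K] (k : ℕ) : Finset K[X] := by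
  classical
  exact (k.divisors.biUnion (monicFinset K)).filter Irreducible

lemma mem_irredFinset {k : ℕ} (hk : k ≠ 0) {f : K[X]} :
    f ∈ irredFinset K k ↔ f.Monic ∧ Irreducible f ∧ f.natDegree ∣ k := by
  simp [irredFinset, mem_monicFinset, hk]
  tauto

/-- The multiplicative function on monic polynomials attached to a multiplicative character `χ`
and an additive character `ψ`: it sends the characteristic polynomial of an element to `χ` of its
norm times `ψ` of its trace. -/
def monicChar (χ : MulChar K R) (ψ : AddChar K R) (f : K[X]) : R :=
  χ ((-1) ^ f.natDegree * f.coeff 0) * ψ (-f.nextCoeff)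

omit [Fintype K] in
lemma monicChar_one (χ : MulChar K R) (ψ : AddChar K R) : monicChar χ ψ 1 = 1 := by
  simp [monicChar, nextCoeff]

omit [Fintype K] in
lemma monicChar_mul (χ : MulChar K R) (ψ : AddChar K R) {f g : K[X]} (hf : f.Monic)
    (hg : g.Monic) : monicChar χ ψ (f * g) = monicChar χ ψ f * monicChar χ ψ g := by
  simp only [monicChar, hf.natDegree_mul hg, hf.nextCoeff_mul hg, mul_coeff_zero, neg_add,
    AddChar.map_add_eq_mul, pow_add]
  rw [mul_mul_mul_comm ((-1 : K) ^ f.natDegree), map_mul]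
  ring

omit [Fintype K] in
lemma monicChar_pow (χ : MulChar K R) (ψ : AddChar K R) {f : K[X]} (hf : f.Monic) (e : ℕ) :
    monicChar χ ψ (f ^ e) = monicChar χ ψ f ^ e := by
  induction e with
  | zero => simp [monicChar_one]
  | succ e ih => rw [pow_succ, monicChar_mul χ ψ (hf.pow e) hf, ih, pow_succ]

/-- The sum of `monicChar` over the monic polynomials of degree `k`. -/
def monicSum (χ : MulChar K R) (ψ : AddChar K R) (k : ℕ) : R :=
  ∑ f ∈ monicFinset K k, monicChar χ ψ f

/-- The sum of the von Mangoldt weighted values of `monicChar` over the prime powers of degree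
`k`. -/
def primePowerSum (χ : MulChar K R) (ψ : AddChar K R) (k : ℕ) : R :=
  ∑ f ∈ irredFinset K k, (f.natDegree : R) * monicChar χ ψ f ^ (k / f.natDegree)

lemma monicSum_zero (χ : MulChar K R) (ψ : AddChar K R) : monicSum χ ψ 0 = 1 := by
  have : monicFinset K 0 = {1} := by
    ext f
    rw [mem_monicFinset, Finset.mem_singleton]
    exact ⟨fun h => eq_one_of_monic_natDegree_zero h.1 h.2, fun h => h ▸ by simp⟩
  rw [monicSum, this, Finset.sum_singleton, monicChar_one]

lemma monicSum_one (χ : MulChar K R) (ψ : AddChar K R) : monicSum χ ψ 1 = gaussSum χ ψ := by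
  rw [monicSum, gaussSum]
  symm
  refine Finset.sum_bij (fun a _ => X - C a) (fun a _ => ?_) (fun a _ b _ h => ?_)
    (fun f hf => ?_) (fun a _ => ?_)
  · exact mem_monicFinset.2 ⟨monic_X_sub_C a, natDegree_X_sub_C a⟩
  · simpa using h
  · obtain ⟨hm, hd⟩ := mem_monicFinset.1 hf
    exact ⟨-f.coeff 0, Finset.mem_univ _, by simpa using (hm.eq_X_add_C hd).symm⟩
  · simp [monicChar, nextCoeff_X_sub_C]

/-- Adding `c X ^ (k - 1)` permutes the monic polynomials of degree `k`. For `k ≥ 2` it leaves the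
constant term alone and only shifts the trace, so the sum is fixed by a factor `ψ c ≠ 1`. Hence the
L-series of `monicChar` is the linear polynomial `1 + gaussSum χ ψ * t`. -/
lemma monicSum_eq_zero [IsDomain R] (χ : MulChar K R) {ψ : AddChar K R} (hψ : ψ ≠ 1) {k : ℕ}
    (hk : 2 ≤ k) : monicSum χ ψ k = 0 := by
  obtain ⟨c, hc⟩ := AddChar.ne_one_iff.1 hψ
  have key : ∀ a : K, ∀ f ∈ monicFinset K k, f + C a * X ^ (k - 1) ∈ monicFinset K k := by
    intro a f hf
    obtain ⟨hm, hd⟩ := mem_monicFinset.1 hf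
    have hlt : (C a * X ^ (k - 1)).degree < f.degree := by
      rw [hm.ne_zero |> degree_eq_natDegree, hd]
      exact (degree_C_mul_X_pow_le _ _).trans_lt (by exact_mod_cast (by lia))
    exact mem_monicFinset.2 ⟨hm.add_of_left hlt, by
      rw [natDegree_eq_of_degree_eq (degree_add_eq_left_of_degree_lt hlt), hd]⟩
  have h : monicSum χ ψ k = ψ c * monicSum χ ψ k := by
    simp only [monicSum, Finset.mul_sum]
    refine Finset.sum_bij' (fun f _ => f + C c * X ^ (k - 1)) (fun f _ => f + C (-c) * X ^ (k - 1))
      (key c) (key (-c)) (fun f _ => by simp) (fun f _ => by simp) (fun f hf => ?_)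
    have h1 := mem_monicFinset.1 hf
    have h2 := mem_monicFinset.1 (key c f hf)
    simp only [monicChar, h1.2, h2.2]
    rw [nextCoeff_of_natDegree_pos (by lia), nextCoeff_of_natDegree_pos (by lia), h1.2, h2.2]
    simp only [coeff_add, coeff_C_mul, coeff_X_pow, if_true, neg_add, AddChar.map_add_eq_mul]
    rw [if_neg (by lia), mul_zero, add_zero, mul_one]
    calc _ = χ ((-1) ^ k * f.coeff 0) * ψ (-f.coeff (k - 1)) * ψ (c + -c) := by simp
      _ = _ := by rw [AddChar.map_add_eq_mul]; ring
  have : (1 - ψ c) * monicSum χ ψ k = 0 := by linear_combination h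
  exact (mul_eq_zero.1 this).resolve_left (sub_ne_zero.2 (Ne.symm hc))

/-- The degree of a monic polynomial, counted through the prime powers dividing it. -/
lemma natDegree_eq_sum_irred {k : ℕ} {f : K[X]} (hf : f ∈ monicFinset K k)
    {I : Finset K[X]} (hI : ∀ P, P ∈ I ↔ P.Monic ∧ Irreducible P ∧ P.natDegree ≤ k) :
    (k : R) = ∑ P ∈ I, ∑ e ∈ Finset.Icc 1 k, open Classical in
      if P ^ e ∣ f then (P.natDegree : R) else 0 := by
  classical
  obtain ⟨hm, hd⟩ := mem_monicFinset.1 hf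
  have hf0 := hm.ne_zero
  have hprod : (normalizedFactors f).prod = f := by
    have := leadingCoeff_mul_prod_normalizedFactors f
    rwa [hm.leadingCoeff, C_1, one_mul] at this
  have hsub : ∀ P ∈ (normalizedFactors f).toFinset, P ∈ I := by
    intro P hP
    rw [Multiset.mem_toFinset, Polynomial.mem_normalizedFactors_iff hf0] at hP
    exact (hI P).2 ⟨hP.2.1, hP.1, hd ▸ natDegree_le_of_dvd hP.2.2 hf0⟩
  have hdeg : k = ∑ P ∈ I, (normalizedFactors f).count P * P.natDegree := by
    conv_lhs => rw [← hd, ← hprod]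
    rw [natDegree_multiset_prod _ (zero_notMem_normalizedFactors f),
      Finset.sum_multiset_map_count]
    simp only [smul_eq_mul]
    refine Finset.sum_subset hsub fun P _ hP => ?_
    rw [Multiset.count_eq_zero_of_notMem (fun h => hP (Multiset.mem_toFinset.2 h)), zero_mul]
  conv_lhs => rw [hdeg]
  push_cast
  refine Finset.sum_congr rfl fun P hP => ?_
  obtain ⟨hPm, hPi, hPd⟩ := (hI P).1 hP
  have hiff : ∀ e, P ^ e ∣ f ↔ e ≤ (normalizedFactors f).count P := by
    intro e
    rw [pow_dvd_iff_le_emultiplicity, emultiplicity_eq_count_normalizedFactors hPi hf0,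
      hPm.normalize_eq_self]
    exact_mod_cast Iff.rfl
  -- The multiplicity is at most `k`, so exponents in `Icc 1 k` see every power of `P` dividing `f`.
  have hle : (normalizedFactors f).count P ≤ k := by
    have h1 := natDegree_le_of_dvd ((hiff _).2 le_rfl) hf0
    rw [natDegree_pow, hd] at h1
    exact (Nat.le_mul_of_pos_right _ hPi.natDegree_pos).trans h1
  simp only [hiff, ← Finset.sum_filter, Finset.sum_const, nsmul_eq_mul]
  congr 2
  have : (Finset.Icc 1 k).filter (· ≤ (normalizedFactors f).count P)
      = Finset.Icc 1 ((normalizedFactors f).count P) := by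
    ext e; simp; lia
  rw [this]; simp

/-- Multiples of `Q` are parametrized by their monic cofactors. This evaluates the inner sum once `k
* monicSum χ ψ k` is expanded over the prime powers dividing each polynomial. -/
lemma sum_monicFinset_dvd (χ : MulChar K R) (ψ : AddChar K R) {k : ℕ} {Q : K[X]} (hQ : Q.Monic) :
    (∑ f ∈ monicFinset K k, open Classical in if Q ∣ f then monicChar χ ψ f else 0) =
      if Q.natDegree ≤ k then monicChar χ ψ Q * monicSum χ ψ (k - Q.natDegree) else 0 := by
  classical
  rw [← Finset.sum_filter]
  split_ifs with h
  · rw [monicSum, Finset.mul_sum]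
    symm
    refine Finset.sum_bij (fun g _ => Q * g) (fun g hg => ?_) (fun a _ b _ hab => ?_)
      (fun f hf => ?_) (fun g hg => ?_)
    · obtain ⟨h1, h2⟩ := mem_monicFinset.1 hg
      rw [Finset.mem_filter, mem_monicFinset]
      exact ⟨⟨hQ.mul h1, by rw [hQ.natDegree_mul h1, h2]; lia⟩, dvd_mul_right _ _⟩
    · exact mul_left_cancel₀ hQ.ne_zero hab
    · rw [Finset.mem_filter, mem_monicFinset] at hf
      obtain ⟨⟨hm, hd⟩, g, rfl⟩ := hf
      have hg := hQ.of_mul_monic_left hm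
      exact ⟨g, mem_monicFinset.2 ⟨hg, by rw [← hd, hQ.natDegree_mul hg]; lia⟩, rfl⟩
    · rw [monicChar_mul χ ψ hQ (mem_monicFinset.1 hg).1]
  · refine Finset.sum_eq_zero fun f hf => ?_
    rw [Finset.mem_filter, mem_monicFinset] at hf
    exact absurd (hf.1.2 ▸ natDegree_le_of_dvd hf.2 hf.1.1.ne_zero) h

/-- The logarithmic derivative of the Euler product. -/
lemma mul_monicSum_eq (χ : MulChar K R) (ψ : AddChar K R) (k : ℕ) :
    (k : R) * monicSum χ ψ k =
      ∑ j ∈ Finset.Icc 1 k, primePowerSum χ ψ j * monicSum χ ψ (k - j) := by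
  classical
  set I : Finset K[X] := ((Finset.Icc 1 k).biUnion (monicFinset K)).filter Irreducible with hI'
  have hI : ∀ P, P ∈ I ↔ P.Monic ∧ Irreducible P ∧ P.natDegree ≤ k := by
    intro P
    simp only [hI', Finset.mem_filter, Finset.mem_biUnion, mem_monicFinset, Finset.mem_Icc]
    constructor
    · rintro ⟨⟨a, ha, h1, rfl⟩, h2⟩; exact ⟨h1, h2, ha.2⟩
    · rintro ⟨h1, h2, h3⟩; exact ⟨⟨_, ⟨h2.natDegree_pos, h3⟩, h1, rfl⟩, h2⟩
  have h1 : (k : R) * monicSum χ ψ k = ∑ P ∈ I, ∑ e ∈ Finset.Icc 1 k,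
      (P.natDegree : R) * if e * P.natDegree ≤ k then
        monicChar χ ψ P ^ e * monicSum χ ψ (k - e * P.natDegree) else 0 := by
    calc _ = ∑ f ∈ monicFinset K k, ∑ P ∈ I, ∑ e ∈ Finset.Icc 1 k,
          (if P ^ e ∣ f then (P.natDegree : R) else 0) * monicChar χ ψ f := by
          rw [monicSum, Finset.mul_sum]
          refine Finset.sum_congr rfl fun f hf => ?_
          rw [natDegree_eq_sum_irred (R := R) hf hI, Finset.sum_mul]
          refine Finset.sum_congr rfl fun P hP => ?_
          rw [Finset.sum_mul]
      _ = _ := by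
          rw [Finset.sum_comm]
          refine Finset.sum_congr rfl fun P hP => ?_
          rw [Finset.sum_comm]
          refine Finset.sum_congr rfl fun e he => ?_
          have hPm := ((hI P).1 hP).1
          have := sum_monicFinset_dvd χ ψ (k := k) (hPm.pow e)
          rw [natDegree_pow, monicChar_pow χ ψ hPm] at this
          rw [← this, Finset.mul_sum]
          refine Finset.sum_congr rfl fun f hf => ?_
          split_ifs <;> simp
  have h2 : ∀ j ∈ Finset.Icc 1 k, irredFinset K j = I.filter (fun P => P.natDegree ∣ j) := by
    intro j hj
    rw [Finset.mem_Icc] at hj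
    ext P
    rw [mem_irredFinset (by lia), Finset.mem_filter, hI]
    constructor
    · rintro ⟨a, b, c⟩; exact ⟨⟨a, b, (Nat.le_of_dvd (by lia) c).trans hj.2⟩, c⟩
    · rintro ⟨⟨a, b, -⟩, c⟩; exact ⟨a, b, c⟩
  have h3 : ∑ j ∈ Finset.Icc 1 k, primePowerSum χ ψ j * monicSum χ ψ (k - j) =
      ∑ P ∈ I, ∑ j ∈ Finset.Icc 1 k, if P.natDegree ∣ j then
        (P.natDegree : R) * monicChar χ ψ P ^ (j / P.natDegree) * monicSum χ ψ (k - j) else 0 := by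
    rw [Finset.sum_comm]
    refine Finset.sum_congr rfl fun j hj => ?_
    rw [primePowerSum, h2 j hj, Finset.sum_mul, Finset.sum_filter]
  rw [h1, h3]
  refine Finset.sum_congr rfl fun P hP => ?_
  have hd := ((hI P).1 hP).2.1.natDegree_pos
  simp only [mul_ite, mul_zero]
  rw [← Finset.sum_filter, ← Finset.sum_filter]
  refine Finset.sum_bij (fun e _ => e * P.natDegree) (fun e he => ?_) (fun a _ b _ hab => ?_)
    (fun j hj => ?_) (fun e he => ?_)
  · simp only [Finset.mem_filter, Finset.mem_Icc] at he ⊢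
    exact ⟨⟨Nat.mul_pos he.1.1 hd, he.2⟩, dvd_mul_left _ _⟩
  · exact Nat.eq_of_mul_eq_mul_right hd hab
  · simp only [Finset.mem_filter, Finset.mem_Icc] at hj
    obtain ⟨⟨a, b⟩, c, rfl⟩ := hj
    refine ⟨c, ?_, mul_comm _ _⟩
    simp only [Finset.mem_filter, Finset.mem_Icc]
    exact ⟨⟨Nat.pos_of_mul_pos_left a, (Nat.le_mul_of_pos_left _ hd).trans b⟩, by rwa [mul_comm]⟩
  · rw [Nat.mul_div_cancel _ hd, mul_assoc]

/-- Since `monicSum` vanishes from degree 2 on, only the last two terms of the logarithmic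
derivative survive, and each prime power sum is the previous one times `-gaussSum χ ψ`. -/
lemma primePowerSum_eq [IsDomain R] (χ : MulChar K R) {ψ : AddChar K R} (hψ : ψ ≠ 1) (m : ℕ) :
    primePowerSum χ ψ (m + 1) = (-gaussSum χ ψ) ^ m * gaussSum χ ψ := by
  induction m with
  | zero =>
    have := mul_monicSum_eq χ ψ 1
    simpa [monicSum_zero, monicSum_one] using this.symm
  | succ m ih =>
    have h := mul_monicSum_eq χ ψ (m + 2)
    rw [monicSum_eq_zero χ hψ (by lia), mul_zero,
      Finset.sum_Icc_succ_top (by lia), Finset.sum_Icc_succ_top (by lia)] at h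
    rw [Finset.sum_eq_zero, zero_add, ih, show m + 2 - (m + 1) = 1 by lia, Nat.sub_self,
      monicSum_zero, monicSum_one] at h
    · linear_combination -h
    · intro j hj
      rw [Finset.mem_Icc] at hj
      rw [monicSum_eq_zero χ hψ (by lia), mul_zero]

variable {L : Type*} [Field L] [Fintype L] [Algebra K L]

omit [Fintype K] in
-- The characteristic polynomial of `x` is its minimal polynomial raised to the power `[L : K(x)]`,
-- and norm and trace are read off from it.
lemma monicChar_minpoly_pow (χ : MulChar K R) (ψ : AddChar K R) (x : L) :
    monicChar χ ψ (minpoly K x) ^ (Module.finrank K L / (minpoly K x).natDegree) =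
      χ (Algebra.norm K x) * ψ (Algebra.trace K L x) := by
  have hx : IsIntegral K x := .of_finite K x
  have hd : Module.finrank K L / (minpoly K x).natDegree = Module.finrank K⟮x⟯ L := by
    rw [← IntermediateField.adjoin.finrank hx, ← Module.finrank_mul_finrank K K⟮x⟯ L,
      Nat.mul_div_cancel_left _ Module.finrank_pos]
  have hn : Algebra.norm K (IntermediateField.AdjoinSimple.gen K x) =
      (-1) ^ (minpoly K x).natDegree * (minpoly K x).coeff 0 := by
    have := Algebra.PowerBasis.norm_gen_eq_coeff_zero_minpoly
      (IntermediateField.adjoin.powerBasis hx)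
    simpa [IntermediateField.minpoly_gen K x] using this
  rw [hd, Algebra.norm_eq_norm_adjoin, hn, trace_eq_finrank_mul_minpoly_nextCoeff, monicChar,
    mul_pow, map_pow, ← nsmul_eq_mul, AddChar.map_nsmul_eq_pow]

/-- Such a `P` divides `X ^ |L| - X`, so it splits in `L`; it is separable, and its roots are
exactly the elements with minimal polynomial `P`. -/
lemma card_minpoly_eq [DecidableEq K[X]] {P : K[X]} (hP : P ∈ irredFinset K (Module.finrank K L)) :
    (Finset.univ.filter (fun x : L => minpoly K x = P)).card = P.natDegree := by
  classical
  obtain ⟨hm, hi, hd⟩ := (mem_irredFinset Module.finrank_pos.ne').1 hP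
  have hdvd := hi.natDegree_dvd_iff_dvd_X_pow_card_pow_sub_X.1 hd
  have hcard : Nat.card K ^ Module.finrank K L = Fintype.card L := by
    rw [← Module.natCard_eq_pow_finrank, Nat.card_eq_fintype_card]
  rw [hcard] at hdvd
  have hsp : ((X ^ Fintype.card L - X : K[X]).map (algebraMap K L)).Splits :=
    (FiniteField.isSplittingField_sub L K).splits
  have hne : ((X ^ Fintype.card L - X : K[X]).map (algebraMap K L)) ≠ 0 :=
    Polynomial.map_ne_zero (FiniteField.X_pow_card_sub_X_ne_zero K Fintype.one_lt_card)
  have hPs : (P.map (algebraMap K L)).Splits := hsp.of_dvd hne (Polynomial.map_dvd _ hdvd)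
  have hsep : P.Separable := PerfectField.separable_of_irreducible hi
  have h1 := card_rootSet_eq_natDegree hsep hPs
  rw [← h1, Fintype.card_subtype]
  congr 1
  ext x
  rw [Finset.mem_filter, Finset.mem_filter, mem_rootSet]
  refine ⟨fun h => ⟨h.1, hi.ne_zero, h.2 ▸ minpoly.aeval K x⟩,
    fun h => ⟨h.1, (minpoly.eq_of_irreducible_of_monic hi h.2.2 hm).symm⟩⟩

/-- The **Hasse–Davenport lifting relation**. -/
theorem hasseDavenport [IsDomain R] (χ : MulChar K R) {ψ : AddChar K R} (hψ : ψ ≠ 1) :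
    -∑ x : L, χ (Algebra.norm K x) * ψ (Algebra.trace K L x) =
      (-gaussSum χ ψ) ^ Module.finrank K L := by
  classical
  obtain ⟨m, hm⟩ := Nat.exists_eq_succ_of_ne_zero (Module.finrank_pos (R := K) (M := L)).ne'
  have : ∑ x : L, χ (Algebra.norm K x) * ψ (Algebra.trace K L x) =
      primePowerSum χ ψ (Module.finrank K L) := by
    rw [← Finset.sum_fiberwise_of_maps_to (t := irredFinset K (Module.finrank K L))
      (g := minpoly K), primePowerSum]
    · refine Finset.sum_congr rfl fun P hP => ?_
      rw [← card_minpoly_eq (L := L) hP, ← nsmul_eq_mul]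
      refine Finset.sum_eq_card_nsmul fun x hx => ?_
      rw [card_minpoly_eq hP, ← monicChar_minpoly_pow, (Finset.mem_filter.1 hx).2]
    · intro x _
      have hx : IsIntegral K x := .of_finite K x
      exact (mem_irredFinset Module.finrank_pos.ne').2 ⟨minpoly.monic hx, minpoly.irreducible hx,
        minpoly.degree_dvd hx⟩
  rw [this, hm, Nat.succ_eq_add_one, primePowerSum_eq χ hψ]
  ring

end HasseDavenport

end DiagExpSum

end

noncomputable section

open Polynomial

namespace DiagExpSum

/-! ### Norms in `ℂ_p` and Teichmüller characters -/

section Teichmuller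

variable {p : ℕ} [Fact p.Prime]

/-- The additive group of elements of `ℂ_p` of norm less than `1`. -/
def openUnitBall (p : ℕ) [Fact p.Prime] : AddSubgroup ℂ_[p] where
  carrier := {x | ‖x‖ < 1}
  zero_mem' := by simp
  add_mem' := fun {a b} ha hb =>
    (IsUltrametricDist.norm_add_le_max a b).trans_lt (max_lt ha hb)
  neg_mem' := fun {a} ha => by simpa using ha

lemma mem_openUnitBall {x : ℂ_[p]} : x ∈ openUnitBall p ↔ ‖x‖ < 1 := Iff.rfl

lemma mul_mem_openUnitBall {a b : ℂ_[p]} (ha : ‖a‖ ≤ 1) (hb : b ∈ openUnitBall p) :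
    a * b ∈ openUnitBall p := by
  rw [mem_openUnitBall, norm_mul]
  exact (mul_le_of_le_one_left (norm_nonneg b) ha).trans_lt hb

lemma norm_eq_of_sub_mem_openUnitBall {a b : ℂ_[p]} (h : a - b ∈ openUnitBall p) (hb : ‖b‖ = 1) :
    ‖a‖ = 1 := by
  have : ‖(a - b) + b‖ = max ‖a - b‖ ‖b‖ :=
    IsUltrametricDist.norm_add_eq_max_of_norm_ne_norm (by rw [hb]; exact (mem_openUnitBall.1 h).ne)
  rw [sub_add_cancel, hb, max_eq_right (mem_openUnitBall.1 h).le] at this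
  exact this

lemma norm_natCast_le_one (m : ℕ) : ‖(m : ℂ_[p])‖ ≤ 1 :=
  IsUltrametricDist.norm_natCast_le_one ℂ_[p] m

lemma norm_prime : ‖(p : ℂ_[p])‖ = (p : ℝ)⁻¹ := by
  have := PadicComplex.norm_extends' p (p : ℚ_[p])
  rw [Padic.norm_p] at this
  rw [← this, map_natCast, PadicComplex.coe_natCast]

lemma prime_mem_openUnitBall : (p : ℂ_[p]) ∈ openUnitBall p := by
  rw [mem_openUnitBall, norm_prime]
  exact inv_lt_one_of_one_lt₀ (by exact_mod_cast (Fact.out : p.Prime).one_lt)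

lemma norm_eq_one_of_pow_eq_one {x : ℂ_[p]} {m : ℕ} (hm : m ≠ 0) (h : x ^ m = 1) : ‖x‖ = 1 := by
  have : ‖x‖ ^ m = 1 := by rw [← norm_pow, h, norm_one]
  exact (pow_eq_one_iff_of_nonneg (norm_nonneg x) hm).1 this

lemma pow_sub_one_eq_mul (x : ℂ_[p]) (m : ℕ) :
    x ^ m - 1 = (x - 1) * ∑ i ∈ Finset.range m, x ^ i := by
  rw [mul_comm, geom_sum_mul]

lemma norm_pow_sub_one_le {x : ℂ_[p]} (hx : ‖x‖ = 1) (m : ℕ) : ‖x ^ m - 1‖ ≤ ‖x - 1‖ := by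
  rw [pow_sub_one_eq_mul, norm_mul]
  refine mul_le_of_le_one_right (norm_nonneg _) ?_
  exact IsUltrametricDist.norm_sum_le_of_forall_le_of_nonneg zero_le_one
    fun i _ => by rw [norm_pow, hx, one_pow]

section Zeta

variable {ζ : ℂ_[p]} (hζ : IsPrimitiveRoot ζ p)
include hζ

lemma norm_zeta : ‖ζ‖ = 1 :=
  norm_eq_one_of_pow_eq_one (Fact.out : p.Prime).ne_zero hζ.pow_eq_one

/-- The product of the `1 - ζ ^ k` for `0 < k < p` is `p`. All factors have the same norm, because
`ζ` and `ζ ^ k` are powers of each other and `x - 1` divides `x ^ m - 1` with integral quotient. -/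
lemma norm_zeta_sub_one_pow : ‖ζ - 1‖ ^ (p - 1) = (p : ℝ)⁻¹ := by
  have hp := (Fact.out : p.Prime)
  have hζ' : IsPrimitiveRoot ζ (p - 1 + 1) := by rwa [Nat.sub_add_cancel hp.one_le]
  have h := congrArg norm hζ'.prod_one_sub_pow_eq_order
  rw [norm_prod, ← Nat.cast_add_one, Nat.sub_add_cancel hp.one_le, norm_prime] at h
  rw [← h, Finset.prod_congr rfl (g := fun _ => ‖ζ - 1‖), Finset.prod_const, Finset.card_range]
  intro k hk
  rw [Finset.mem_range] at hk
  rw [norm_sub_rev]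
  refine le_antisymm (norm_pow_sub_one_le (norm_zeta hζ) _) ?_
  have hc : (k + 1).Coprime p :=
    (Nat.coprime_of_lt_prime (by lia) (by lia) hp).symm
  obtain ⟨m, -, hm⟩ := Nat.exists_mul_mod_eq_one_of_coprime hc hp.one_lt
  have : ζ = (ζ ^ (k + 1)) ^ m := by
    rw [← pow_mul, ← Nat.div_add_mod ((k + 1) * m) p, hm, pow_add, pow_mul, hζ.pow_eq_one]
    simp
  conv_lhs => rw [this]
  exact norm_pow_sub_one_le (by rw [norm_pow, norm_zeta hζ, one_pow]) m

lemma norm_zeta_sub_one_lt : ζ - 1 ∈ openUnitBall p := by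
  have hp := (Fact.out : p.Prime)
  rw [mem_openUnitBall]
  by_contra! h
  have := one_le_pow₀ h (n := p - 1)
  rw [norm_zeta_sub_one_pow hζ] at this
  exact (inv_lt_one_of_one_lt₀ (by exact_mod_cast hp.one_lt : (1 : ℝ) < p)).not_ge this

end Zeta

variable {K : Type*} [Field K] [Fintype K]

section TraceChar

variable [Algebra (ZMod p) K]

variable {ζ : ℂ_[p]} (hζ : IsPrimitiveRoot ζ p)

/-- The additive character `x ↦ ζ ^ Tr x` of a finite field of characteristic `p`. -/
def traceChar (K : Type*) [Field K] [Algebra (ZMod p) K] :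
    AddChar K ℂ_[p] :=
  (AddChar.zmodChar p hζ.pow_eq_one).compAddMonoidHom (Algebra.trace (ZMod p) K).toAddMonoidHom

omit [Fintype K] in
lemma traceChar_apply (x : K) :
    traceChar hζ K x = ζ ^ (Algebra.trace (ZMod p) K x).val := rfl

lemma traceChar_ne_one : traceChar hζ K ≠ 1 := by
  rw [AddChar.ne_one_iff]
  obtain ⟨x, hx⟩ := Algebra.trace_surjective (ZMod p) K 1
  refine ⟨x, ?_⟩
  rw [traceChar_apply, hx, ZMod.val_one, pow_one]
  exact hζ.ne_one (Fact.out : p.Prime).one_lt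

omit [Fintype K] in
lemma traceChar_algEquiv (e : K ≃ₐ[ZMod p] K) (x : K) : traceChar hζ K (e x) = traceChar hζ K x := by
  rw [traceChar_apply, traceChar_apply, Algebra.trace_eq_of_algEquiv]

end TraceChar

/-- A multiplicative character with values in `ℂ_p` is a Teichmüller character if it is additive
modulo the maximal ideal. -/
def IsTeichmuller (ω : MulChar K ℂ_[p]) : Prop :=
  ∀ x y, ω (x + y) - (ω x + ω y) ∈ openUnitBall p

lemma norm_mulChar (χ : MulChar K ℂ_[p]) {x : K} (hx : x ≠ 0) : ‖χ x‖ = 1 := by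
  refine norm_eq_one_of_pow_eq_one (m := Fintype.card K - 1)
    (Nat.sub_ne_zero_of_lt Fintype.one_lt_card) ?_
  rw [← map_pow, FiniteField.pow_card_sub_one_eq_one x hx, map_one]

lemma norm_mulChar_le (χ : MulChar K ℂ_[p]) (x : K) : ‖χ x‖ ≤ 1 := by
  by_cases hx : x = 0
  · simp [hx, MulChar.map_zero]
  · exact (norm_mulChar χ hx).le

namespace IsTeichmuller

variable {ω : MulChar K ℂ_[p]} (hω : IsTeichmuller ω)
include hω

omit [Fintype K] in
lemma sum_sub_mem {ι : Type*} (s : Finset ι) (f : ι → K) :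
    ω (∑ i ∈ s, f i) - ∑ i ∈ s, ω (f i) ∈ openUnitBall p := by
  classical
  induction s using Finset.induction_on with
  | empty => simp [MulChar.map_zero, zero_mem]
  | insert a s ha ih =>
    rw [Finset.sum_insert ha, Finset.sum_insert ha]
    have := add_mem (hω (f a) (∑ i ∈ s, f i)) ih
    convert! this using 1
    ring

omit [Fintype K] in
lemma natCast_sub_mem (m : ℕ) : ω (m : K) - m ∈ openUnitBall p := by
  have := hω.sum_sub_mem (Finset.range m) (fun _ => (1 : K))
  simpa using this

/-- By additivity modulo the maximal ideal, `ω (x - y)` would have norm less than 1, whereas `ω` has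
norm 1 at nonzero elements. -/
lemma eq_of_sub_mem {x y : K} (h : ω x - ω y ∈ openUnitBall p) : x = y := by
  by_contra hne
  have h1 := hω (x - y) y
  rw [sub_add_cancel] at h1
  have h2 := sub_mem h h1
  rw [show ω x - ω y - (ω x - (ω (x - y) + ω y)) = ω (x - y) by ring, mem_openUnitBall,
    norm_mulChar ω (sub_ne_zero.2 hne)] at h2
  exact h2.false

lemma injective : Function.Injective ω := fun x y h =>
  hω.eq_of_sub_mem (by rw [h, sub_self]; exact zero_mem _)

lemma pow_eq_one_iff (a : ℕ) : ω ^ a = 1 ↔ Fintype.card K - 1 ∣ a := by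
  classical
  constructor
  · intro h
    obtain ⟨g, hg⟩ := IsCyclic.exists_generator (α := Kˣ)
    have h1 : ω ((g ^ a : Kˣ) : K) = ω 1 := by
      rw [Units.val_pow_eq_pow_val, map_pow, ← MulChar.pow_apply_coe, h, MulChar.one_apply_coe,
        map_one]
    have h2 : g ^ a = 1 := Units.ext (hω.injective h1)
    rw [← Fintype.card_units, ← orderOf_eq_card_of_forall_mem_zpowers hg |>.trans
      Nat.card_eq_fintype_card]
    exact orderOf_dvd_of_pow_eq_one h2
  · rintro ⟨c, rfl⟩
    rw [pow_mul, ← Fintype.card_units, MulChar.pow_card_eq_one, one_pow]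

omit [Fintype K] in
lemma comp_ringHom {F : Type*} [Field F] (φ : F →+* K) :
    ∃ ω' : MulChar F ℂ_[p], IsTeichmuller ω' ∧ ∀ x, ω' x = ω (φ x) := by
  refine ⟨⟨((ω : K →* ℂ_[p]).comp (φ : F →* K)), fun x hx => ?_⟩, fun x y => ?_, fun x => rfl⟩
  · have : x = 0 := by simpa using hx
    simp [this, MulChar.map_zero]
  · have := hω (φ x) (φ y)
    rw [← map_add] at this
    exact this

end IsTeichmuller

variable [Algebra (ZMod p) K]

/-- Two Teichmüller characters differ by an automorphism of the field. -/
lemma IsTeichmuller.exists_algEquiv {ω ω' : MulChar K ℂ_[p]} (hω : IsTeichmuller ω)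
    (hω' : IsTeichmuller ω') : ∃ e : K ≃ₐ[ZMod p] K, ∀ x, ω (e x) = ω' x := by
  classical
  have hex : ∀ x, ∃ y, ω y = ω' x := by
    intro x
    by_cases hx : x = 0
    · exact ⟨0, by simp [hx, MulChar.map_zero]⟩
    have hcard : 0 < Fintype.card K - 1 := Nat.sub_pos_of_lt Fintype.one_lt_card
    -- By counting, the nonzero values of `ω` are all the `(q - 1)`-th roots of unity, with `q =
    -- |K|`, so every nonzero value of `ω'` is also a value of `ω`.
    have himg : (Finset.univ.erase (0 : K)).image ω =
        Polynomial.nthRootsFinset (Fintype.card K - 1) (1 : ℂ_[p]) := by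
      refine Finset.eq_of_subset_of_card_le ?_ ?_
      · intro z hz
        obtain ⟨y, hy, rfl⟩ := Finset.mem_image.1 hz
        rw [Polynomial.mem_nthRootsFinset hcard, ← map_pow,
          FiniteField.pow_card_sub_one_eq_one y (Finset.ne_of_mem_erase hy), map_one]
      · rw [Finset.card_image_of_injective _ hω.injective, Finset.card_erase_of_mem
          (Finset.mem_univ _), Finset.card_univ, Polynomial.nthRootsFinset]
        exact (Multiset.toFinset_card_le _).trans (Polynomial.card_nthRoots _ _)
    have : ω' x ∈ (Finset.univ.erase (0 : K)).image ω := by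
      rw [himg, Polynomial.mem_nthRootsFinset hcard, ← map_pow,
        FiniteField.pow_card_sub_one_eq_one x hx, map_one]
    obtain ⟨y, -, hy⟩ := Finset.mem_image.1 this
    exact ⟨y, hy⟩
  choose e he using hex
  let φ : K →+* K :=
    { toFun := e
      map_one' := hω.injective (by rw [he, map_one, map_one])
      map_mul' := fun x y => hω.injective (by rw [he, map_mul, map_mul, he, he])
      map_zero' := hω.injective (by rw [he, MulChar.map_zero, MulChar.map_zero])
      map_add' := fun x y => hω.eq_of_sub_mem (by
        have := sub_mem (hω' x y) (hω (e x) (e y))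
        rw [he, he] at this
        rw [he]
        convert! this using 1
        ring) }
  let ψ : K →ₐ[ZMod p] K := ⟨φ, fun r => RingHom.congr_fun
    (Subsingleton.elim (φ.comp (algebraMap (ZMod p) K)) (algebraMap (ZMod p) K)) r⟩
  exact ⟨AlgEquiv.ofBijective ψ (Finite.injective_iff_bijective.1 ψ.toRingHom.injective), he⟩

lemma mem_integers_iff {x : ℂ_[p]} : x ∈ 𝓞_ℂ_[p] ↔ ‖x‖ ≤ 1 := by
  rw [PadicComplex.norm_eq_norm, PadicComplexInt, Valuation.mem_valuationSubring_iff]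
  exact (Valued.toNormedField.norm_le_one_iff).symm

lemma residue_eq_zero_iff (x : 𝓞_ℂ_[p]) :
    IsLocalRing.residue 𝓞_ℂ_[p] x = 0 ↔ (x : ℂ_[p]) ∈ openUnitBall p := by
  rw [IsLocalRing.residue_eq_zero_iff, IsLocalRing.mem_maximalIdeal, mem_nonunits_iff,
    mem_openUnitBall, ← not_iff_not, not_not, not_lt]
  constructor
  · intro h
    obtain ⟨y, hy⟩ := h.exists_right_inv
    have h1 : ‖(x : ℂ_[p])‖ * ‖(y : ℂ_[p])‖ = 1 := by
      rw [← norm_mul, ← norm_one (α := ℂ_[p])]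
      exact congrArg norm (congrArg Subtype.val hy)
    by_contra! hlt
    have := mul_lt_one_of_nonneg_of_lt_one_left (norm_nonneg _) hlt (mem_integers_iff.1 y.2)
    exact this.ne h1
  · intro h
    have hx0 : (x : ℂ_[p]) ≠ 0 := by
      intro h0; rw [h0, norm_zero] at h; exact (zero_lt_one.trans_le h).false
    refine IsUnit.of_mul_eq_one ⟨(x : ℂ_[p])⁻¹, mem_integers_iff.2 ?_⟩
      (Subtype.ext (mul_inv_cancel₀ hx0))
    rw [norm_inv]
    exact inv_le_one_of_one_le₀ h

variable (p K) in
-- Reducing a primitive `(q - 1)`-th root of unity, `q = |K|`, shows that `X ^ q - X` splits over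
-- the residue field of `ℂ_p`, so `K` embeds there. A nonzero element lifts uniquely to a `(q -
-- 1)`-th root of unity. Uniqueness makes the lift multiplicative, and it is additive modulo the
-- maximal ideal because the embedding is.
lemma exists_isTeichmuller : ∃ ω : MulChar K ℂ_[p], IsTeichmuller ω := by
  classical
  set O := 𝓞_ℂ_[p]
  set k := IsLocalRing.ResidueField O
  set red : O →+* k := IsLocalRing.residue O
  have : CharP K p := charP_of_injective_algebraMap (algebraMap (ZMod p) K).injective p
  have hp0 : (p : k) = 0 := by
    have := (residue_eq_zero_iff (p : O)).2 (by simpa using prime_mem_openUnitBall)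
    rwa [map_natCast] at this
  have : CharP k p := (CharP.charP_iff_prime_eq_zero Fact.out).2 hp0
  let _ : Algebra (ZMod p) k := ZMod.algebra k p
  set q := Fintype.card K
  have hq : 1 < q := Fintype.one_lt_card
  obtain ⟨f, -, hf⟩ := FiniteField.card K p
  have hq0 : (q : k) = 0 := by
    rw [show q = p ^ (f : ℕ) from hf, Nat.cast_pow, hp0, zero_pow f.ne_zero]
  have : NeZero (((q - 1 : ℕ) : ℂ_[p])) := ⟨Nat.cast_ne_zero.2 (by lia)⟩
  obtain ⟨z, hz⟩ := HasEnoughRootsOfUnity.exists_primitiveRoot ℂ_[p] (q - 1)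
  have hzO : z ∈ O := mem_integers_iff.2
    (norm_eq_one_of_pow_eq_one (m := q - 1) (by lia) hz.pow_eq_one).le
  have hzO' : IsPrimitiveRoot (⟨z, hzO⟩ : O) (q - 1) :=
    IsPrimitiveRoot.of_map_of_injective (f := O.subtype) hz Subtype.val_injective
  have hfac : (X ^ (q - 1) - 1 : k[X]) =
      ∏ ξ ∈ nthRootsFinset (q - 1) (1 : O), (X - C (red ξ)) := by
    have := congrArg (Polynomial.map red) (X_pow_sub_one_eq_prod (by lia) hzO')
    simpa [Polynomial.map_prod] using this
  have hsp : ((X ^ q - X : (ZMod p)[X]).map (algebraMap (ZMod p) k)).Splits := by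
    have : ((X ^ q - X : (ZMod p)[X]).map (algebraMap (ZMod p) k)) = X * (X ^ (q - 1) - 1) := by
      simp only [Polynomial.map_sub, Polynomial.map_pow, map_X]
      rw [mul_sub, ← pow_succ', Nat.sub_add_cancel hq.le, mul_one]
    rw [this, hfac]
    exact Splits.X.mul (Splits.prod fun _ _ => Splits.X_sub_C _)
  have := FiniteField.isSplittingField_sub K (ZMod p)
  let σ : K →ₐ[ZMod p] k := IsSplittingField.lift K (X ^ q - X : (ZMod p)[X]) hsp
  have hex : ∀ x : K, ∃ ξ : O, red ξ = σ x ∧ (x = 0 → ξ = 0) ∧ (x ≠ 0 → ξ ^ (q - 1) = 1) := by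
    intro x
    by_cases hx : x = 0
    · exact ⟨0, by simp [hx], fun _ => rfl, fun h => absurd hx h⟩
    have h1 : eval (σ x) (X ^ (q - 1) - 1 : k[X]) = 0 := by
      simp [← map_pow, q, FiniteField.pow_card_sub_one_eq_one x hx]
    rw [hfac, eval_prod, Finset.prod_eq_zero_iff] at h1
    obtain ⟨ξ, hξ, h2⟩ := h1
    refine ⟨ξ, ?_, fun h => absurd h hx, fun _ => (mem_nthRootsFinset (by lia) 1).1 hξ⟩
    rw [eval_sub, eval_X, eval_C] at h2
    exact (sub_eq_zero.1 h2).symm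
  -- If the quotient `η` of the two roots reduces to 1, the geometric sum `1 + η + ⋯ + η ^ (q - 2)`
  -- reduces to `q - 1 = -1 ≠ 0`. It is therefore nonzero, and `η = 1`.
  have huniq : ∀ ξ ξ' : O, ξ ^ (q - 1) = 1 → ξ' ^ (q - 1) = 1 → red ξ = red ξ' → ξ = ξ' := by
    intro ξ ξ' h h' hr
    have hu : IsUnit ξ' := IsUnit.of_pow_eq_one h' (by lia)
    obtain ⟨u, rfl⟩ := hu
    set η := ξ * (u⁻¹ : Oˣ) with hη
    have hη1 : η ^ (q - 1) = 1 := by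
      rw [hη, mul_pow, h, one_mul, ← Units.val_pow_eq_pow_val, inv_pow]
      have : u ^ (q - 1) = 1 := Units.ext (by simpa using h')
      simp [this]
    have hηr : red η = 1 := by
      rw [hη, map_mul, hr, ← map_mul, Units.mul_inv, map_one]
    have hs : (∑ i ∈ Finset.range (q - 1), η ^ i) * (η - 1) = 0 := by
      rw [geom_sum_mul, hη1, sub_self]
    rcases mul_eq_zero.1 hs with h0 | h0
    · exfalso
      have := congrArg red h0
      simp only [map_sum, map_pow, hηr, one_pow, map_zero, Finset.sum_const, Finset.card_range,
        nsmul_eq_mul, mul_one] at this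
      rw [Nat.cast_sub hq.le, hq0, Nat.cast_one, zero_sub, neg_eq_zero] at this
      exact one_ne_zero this
    · have : η = 1 := sub_eq_zero.1 h0
      rw [hη, Units.mul_inv_eq_one] at this
      exact this
  choose r hr hr0 hr1 using hex
  refine ⟨⟨⟨⟨fun x => (r x : ℂ_[p]), ?_⟩, ?_⟩, ?_⟩, ?_⟩
  · have : r 1 = 1 := huniq _ _ (hr1 1 one_ne_zero) (one_pow _) (by rw [hr, map_one, map_one])
    simp [this]
  · intro x y
    have : r (x * y) = r x * r y := by
      by_cases hx : x = 0
      · rw [hr0 x hx, zero_mul, hr0 _ (by rw [hx, zero_mul])]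
      by_cases hy : y = 0
      · rw [hr0 y hy, mul_zero, hr0 _ (by rw [hy, mul_zero])]
      refine huniq _ _ (hr1 _ (mul_ne_zero hx hy)) ?_ ?_
      · rw [mul_pow, hr1 x hx, hr1 y hy, one_mul]
      · rw [hr, map_mul, map_mul, hr, hr]
    simp [this]
  · intro x hx
    have : r x = 0 := hr0 x (by simpa using hx)
    simp [this]
  · intro x y
    change (r (x + y) : ℂ_[p]) - ((r x : ℂ_[p]) + (r y : ℂ_[p])) ∈ _
    have := (residue_eq_zero_iff (r (x + y) - (r x + r y))).1 (by
      change red _ = 0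
      rw [map_sub, map_add, hr, hr, hr, map_add, sub_self])
    simpa using this

end Teichmuller

end DiagExpSum

end

noncomputable section

namespace DiagExpSum

/-! ### Gauss sums: digit sums, Stickelberger's theorem and extension of the field -/

section Stickelberger

/-- The sum of the fractional parts of `r, p r, …, p^(f-1) r`. -/
def fracSum (p f : ℕ) (r : ℝ) : ℝ := ∑ k ∈ Finset.range f, Int.fract ((p : ℝ) ^ k * r)

lemma fract_pow_mul_div (p k a N : ℕ) :
    Int.fract ((p : ℝ) ^ k * ((a : ℝ) / N)) = ((p ^ k * a % N : ℕ) : ℝ) / N := by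
  rw [← Int.fract_div_natCast_eq_div_natCast_mod]
  push_cast
  rw [mul_div_assoc]

/-- Multiplication by `p` shifts the summands cyclically, since `p ^ f ≡ 1` modulo the denominator.
-/
lemma fracSum_mul_prime {p f : ℕ} (hp : 1 < p) (hf : f ≠ 0) (a : ℕ) :
    fracSum p f ((p * a : ℕ) / (p ^ f - 1 : ℕ)) = fracSum p f (a / (p ^ f - 1 : ℕ)) := by
  have h1 : 1 < p ^ f := Nat.one_lt_pow hf hp
  have hN : (p : ℝ) ^ f = ((p ^ f - 1 : ℕ) : ℝ) + 1 := by
    rw [← Nat.cast_add_one, Nat.sub_add_cancel h1.le]; push_cast; rfl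
  have hN0 : ((p ^ f - 1 : ℕ) : ℝ) ≠ 0 := Nat.cast_ne_zero.2 (by lia)
  set r : ℝ := (a : ℝ) / (p ^ f - 1 : ℕ) with hr
  have e : (((p * a : ℕ) : ℝ) / (p ^ f - 1 : ℕ)) = p * r := by rw [hr]; push_cast; ring
  have hlast : Int.fract ((p : ℝ) ^ f * r) = Int.fract ((p : ℝ) ^ 0 * r) := by
    rw [hN, add_mul, one_mul, pow_zero, one_mul, hr, mul_div_cancel₀ _ hN0, add_comm,
      Int.fract_add_natCast]
  rw [e]
  have h := Finset.sum_range_succ' (fun k => Int.fract ((p : ℝ) ^ k * r)) f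
  rw [Finset.sum_range_succ, hlast] at h
  have h' := add_right_cancel h
  rw [fracSum, fracSum, h']
  refine Finset.sum_congr rfl fun k _ => ?_
  rw [pow_succ, mul_assoc]

lemma sum_pow_div {p f : ℕ} (hp : 1 < p) (hf : f ≠ 0) :
    ∑ k ∈ Finset.range f, (p : ℝ) ^ k / (p ^ f - 1 : ℕ) = ((p - 1 : ℕ) : ℝ)⁻¹ := by
  have h1 : 1 < p ^ f := Nat.one_lt_pow hf hp
  have hp' : (1 : ℝ) < p := by exact_mod_cast hp
  have hq' : (1 : ℝ) < (p : ℝ) ^ f := by exact_mod_cast h1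
  rw [← Finset.sum_div, geom_sum_eq hp'.ne', Nat.cast_sub h1.le, Nat.cast_sub hp.le]
  push_cast
  have a1 : (p : ℝ) - 1 ≠ 0 := by linarith
  have a2 : (p : ℝ) ^ f - 1 ≠ 0 := by linarith
  field_simp

/-- Multiplication by `p ^ k` modulo `p ^ f - 1` rotates the base `p` digits of `a`. The last digit
of `a` is not `p - 1`, so raising it by 1 causes no carry. Concretely, a wrap-around, undone by
multiplying by `p ^ (f - k)`, would make `p` divide `a + 1`. -/
lemma mod_pow_mul_succ {p f a k : ℕ} (hp : 1 < p) (ha : a + 1 < p ^ f - 1) (hpa : ¬ p ∣ a + 1)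
    (hk : k < f) : p ^ k * (a + 1) % (p ^ f - 1) = p ^ k * a % (p ^ f - 1) + p ^ k := by
  set N := p ^ f - 1 with hN
  have hq : p ^ f = N + 1 := by lia
  have hlt : p ^ k * a % N < N := Nat.mod_lt _ (by lia)
  set x := p ^ k * a % N with hx
  have hcong : x + p ^ k ≡ p ^ k * (a + 1) [MOD N] := by
    rw [mul_add, mul_one]
    exact (Nat.mod_modEq _ _).add_right _
  by_cases h : x + p ^ k < N
  · rw [← hcong, Nat.mod_eq_of_lt h]
  exfalso
  obtain ⟨y, hy⟩ := Nat.exists_eq_add_of_le (not_lt.1 h)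
  have hyk : y < p ^ k := by lia
  have hy' : y ≡ p ^ k * (a + 1) [MOD N] := by
    rw [hy] at hcong
    simpa [Nat.ModEq] using hcong
  have hsplit : p ^ (f - k) * p ^ k = N + 1 := by rw [← pow_add, ← hq]; congr 1; lia
  have h2 : p ^ (f - k) * y ≡ a + 1 [MOD N] := by
    have := hy'.mul_left (p ^ (f - k))
    rw [← mul_assoc, hsplit, add_mul, one_mul] at this
    exact this.trans (by simp [Nat.ModEq])
  have hple : p ≤ p ^ (f - k) := Nat.le_self_pow (by lia) p
  have h3 : p ^ (f - k) * y < N := by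
    have : p ^ (f - k) * (y + 1) ≤ N + 1 := hsplit ▸ Nat.mul_le_mul_left _ hyk
    rw [mul_add, mul_one] at this
    lia
  have h4 := Nat.ModEq.eq_of_lt_of_lt h2 h3 ha
  exact hpa (h4 ▸ Dvd.dvd.mul_right (dvd_pow_self p (by lia)) y)

lemma fracSum_succ {p f a : ℕ} (hp : 1 < p) (ha : a + 1 < p ^ f - 1) (hpa : ¬ p ∣ a + 1) :
    fracSum p f ((a + 1 : ℕ) / (p ^ f - 1 : ℕ)) =
      fracSum p f (a / (p ^ f - 1 : ℕ)) + ((p - 1 : ℕ) : ℝ)⁻¹ := by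
  have hf : f ≠ 0 := by rintro rfl; simp at ha
  rw [← sum_pow_div hp hf, fracSum, fracSum, ← Finset.sum_add_distrib]
  refine Finset.sum_congr rfl fun k hk => ?_
  rw [fract_pow_mul_div, fract_pow_mul_div,
    mod_pow_mul_succ hp ha hpa (Finset.mem_range.1 hk), Nat.cast_add, add_div]
  push_cast
  rfl

/-- The fractional parts of `x` and `-x` add up to 1 unless `x` is an integer. No `p ^ k * a / N`
with `N = p ^ f - 1` is one, because `p` is prime to `N` and `0 < a < N`. -/
lemma fracSum_add_sub {p f a : ℕ} (hp : 1 < p) (ha0 : a ≠ 0) (ha : a < p ^ f - 1) :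
    fracSum p f (a / (p ^ f - 1 : ℕ)) + fracSum p f ((p ^ f - 1 - a : ℕ) / (p ^ f - 1 : ℕ)) = f := by
  have hf : f ≠ 0 := by rintro rfl; simp at ha
  set N := p ^ f - 1 with hN
  have hN0 : (N : ℝ) ≠ 0 := Nat.cast_ne_zero.2 (by lia)
  have hcop : Nat.Coprime N p := by
    have h : Nat.Coprime N (N + 1) := by simp
    rw [show N + 1 = p ^ f by lia] at h
    exact (Nat.coprime_pow_right_iff (Nat.pos_of_ne_zero hf) _ _).1 h
  rw [fracSum, fracSum, ← Finset.sum_add_distrib]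
  conv_rhs => rw [← mul_one (f : ℝ), ← nsmul_eq_mul, ← Finset.card_range f, ← Finset.sum_const]
  refine Finset.sum_congr rfl fun k _ => ?_
  have h1 : Int.fract ((p : ℝ) ^ k * ((a : ℝ) / N)) ≠ 0 := by
    rw [fract_pow_mul_div]
    refine div_ne_zero (Nat.cast_ne_zero.2 fun h => ?_) hN0
    have := (hcop.pow_right k).dvd_of_dvd_mul_left (Nat.dvd_of_mod_eq_zero h)
    exact absurd (Nat.le_of_dvd (Nat.pos_of_ne_zero ha0) this) (by lia)
  have h2 : (p : ℝ) ^ k * ((N - a : ℕ) / N) = -((p : ℝ) ^ k * ((a : ℝ) / N)) + (p ^ k : ℕ) := by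
    rw [Nat.cast_sub ha.le]; push_cast; field_simp; ring
  rw [h2, Int.fract_add_natCast, Int.fract_neg h1]
  ring

lemma fracSum_zero (p f : ℕ) : fracSum p f 0 = 0 := by simp [fracSum]

variable {p : ℕ} [Fact p.Prime] {ζ : ℂ_[p]} (hζ : IsPrimitiveRoot ζ p)
variable (K : Type*) [Field K] [Fintype K] [Algebra (ZMod p) K]

/-- The Gauss sum of the `-a`-th power of a Teichmüller character. -/
def teichGauss (a : ℕ) : ℂ_[p] :=
  gaussSum ((exists_isTeichmuller p K).choose⁻¹ ^ a) (traceChar hζ K)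

variable {K}

omit [Fintype K] [Algebra (ZMod p) K] in
lemma inv_pow_apply (ω : MulChar K ℂ_[p]) (a : ℕ) {x : K} (hx : x ≠ 0) :
    (ω⁻¹ ^ a) x = (ω x ^ a)⁻¹ := by
  have := MulChar.pow_apply_coe (ω⁻¹) a (Units.mk0 x hx)
  rw [Units.val_mk0] at this
  rw [this, MulChar.inv_apply_eq_inv', inv_pow]

/-- Changing the Teichmüller character amounts to applying an automorphism of `K`, which preserves
the trace. The choice in `teichGauss` is therefore immaterial. -/
lemma teichGauss_eq {ω : MulChar K ℂ_[p]} (hω : IsTeichmuller ω) (a : ℕ) :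
    teichGauss hζ K a = gaussSum (ω⁻¹ ^ a) (traceChar hζ K) := by
  obtain ⟨e, he⟩ := hω.exists_algEquiv (exists_isTeichmuller p K).choose_spec
  rw [teichGauss, gaussSum, gaussSum]
  refine Fintype.sum_equiv e.toEquiv _ _ fun x => ?_
  change _ = (ω⁻¹ ^ a) (e x) * traceChar hζ K (e x)
  rw [traceChar_algEquiv]
  congr 1
  by_cases hx : x = 0
  · rw [hx, map_zero e, MulChar.map_zero, MulChar.map_zero]
  · rw [inv_pow_apply _ _ hx, inv_pow_apply _ _ (by simpa using hx), he]

lemma teichGauss_mul_prime (a : ℕ) : teichGauss hζ K (p * a) = teichGauss hζ K a := by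
  obtain ⟨ω, hω⟩ := exists_isTeichmuller p K
  rw [teichGauss_eq hζ hω, teichGauss_eq hζ hω, gaussSum, gaussSum]
  refine Fintype.sum_equiv (FiniteField.frobeniusAlgEquivOfAlgebraic (ZMod p) K).toEquiv _ _
    fun x => ?_
  change _ = (ω⁻¹ ^ a) (FiniteField.frobeniusAlgEquivOfAlgebraic (ZMod p) K x) *
    traceChar hζ K (FiniteField.frobeniusAlgEquivOfAlgebraic (ZMod p) K x)
  rw [traceChar_algEquiv, FiniteField.coe_frobeniusAlgEquivOfAlgebraic, ZMod.card]
  congr 1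
  by_cases hx : x = 0
  · simp only [hx, zero_pow (Fact.out : p.Prime).ne_zero, MulChar.map_zero]
  · rw [inv_pow_apply _ _ hx, inv_pow_apply _ _ (pow_ne_zero _ hx), map_pow, pow_mul]

lemma teichGauss_zero : teichGauss hζ K 0 = -1 := by
  rw [teichGauss, pow_zero, gaussSum_one_left (traceChar_ne_one hζ)]

omit [Algebra (ZMod p) K] in
lemma teichmuller_inv_pow_eq_one_iff {ω : MulChar K ℂ_[p]} (hω : IsTeichmuller ω) (a : ℕ) :
    ω⁻¹ ^ a = 1 ↔ Fintype.card K - 1 ∣ a := by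
  rw [inv_pow, inv_eq_one, hω.pow_eq_one_iff]

lemma card_eq_pow_finrank_zmod :
    Fintype.card K = p ^ Module.finrank (ZMod p) K := by
  rw [← Nat.card_eq_fintype_card, Module.natCard_eq_pow_finrank (K := ZMod p), Nat.card_zmod]

/-- As `q = |K| > 2`, the character is nontrivial and `ψ` may be replaced by `ψ - 1 = (ζ - 1) c`.
Modulo the maximal ideal, `c x` is the trace of `x`, hence `∑ ω(x) ^ (p ^ k)`. Against `ω⁻¹` this
sums to `q - 1`, a unit. -/
lemma norm_teichGauss_one (hq : 2 < Fintype.card K) : ‖teichGauss hζ K 1‖ = ‖ζ - 1‖ := by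
  classical
  obtain ⟨ω, hω⟩ := exists_isTeichmuller p K
  have hp := (Fact.out : p.Prime)
  have hπ : ζ - 1 ≠ 0 := sub_ne_zero.2 (hζ.ne_one hp.one_lt)
  set f := Module.finrank (ZMod p) K with hf
  have hqf : Fintype.card K = p ^ f := card_eq_pow_finrank_zmod
  have hf0 : f ≠ 0 := Module.finrank_pos.ne'
  set c : K → ℂ_[p] := fun x => ∑ i ∈ Finset.range (Algebra.trace (ZMod p) K x).val, ζ ^ i
  have hχ : ω⁻¹ ^ 1 ≠ 1 := fun h => by
    have := Nat.le_of_dvd one_pos ((teichmuller_inv_pow_eq_one_iff hω 1).1 h); lia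
  have hg : teichGauss hζ K 1 = (ζ - 1) * ∑ x, (ω⁻¹ ^ 1) x * c x := by
    rw [teichGauss_eq hζ hω, gaussSum, ← sub_zero (∑ x, _), ← MulChar.sum_eq_zero_of_ne_one hχ,
      ← Finset.sum_sub_distrib, Finset.mul_sum]
    refine Finset.sum_congr rfl fun x _ => ?_
    rw [traceChar_apply, ← mul_sub_one, pow_sub_one_eq_mul]
    ring
  have hc : ∀ x, c x - ∑ k ∈ Finset.range f, ω x ^ p ^ k ∈ openUnitBall p := by
    intro x
    set t := (Algebra.trace (ZMod p) K x).val
    have h1 : c x - (t : ℂ_[p]) ∈ openUnitBall p := by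
      have : c x - (t : ℂ_[p]) = ∑ i ∈ Finset.range t, (ζ ^ i - 1) := by
        rw [Finset.sum_sub_distrib]; simp [c, t]
      rw [this]
      refine sum_mem fun i _ => ?_
      exact (norm_pow_sub_one_le (norm_zeta hζ) i).trans_lt (norm_zeta_sub_one_lt hζ)
    have h2 := hω.natCast_sub_mem t
    have h3 : (t : K) = ∑ k ∈ Finset.range f, x ^ p ^ k := by
      have := FiniteField.algebraMap_trace_eq_sum_pow (ZMod p) K x
      rw [Nat.card_zmod] at this
      rw [← this, ← ZMod.natCast_zmod_val (Algebra.trace (ZMod p) K x), map_natCast]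
    have h4 := hω.sum_sub_mem (Finset.range f) (fun k => x ^ p ^ k)
    rw [← h3] at h4
    simp only [map_pow] at h4
    have := add_mem (sub_mem h1 h2) h4
    convert! this using 1
    ring
  have hmain : (∑ x, (ω⁻¹ ^ 1) x * c x) - ((Fintype.card K - 1 : ℕ) : ℂ_[p]) ∈ openUnitBall p := by
    have hsum : ∑ x, (ω⁻¹ ^ 1) x * ∑ k ∈ Finset.range f, ω x ^ p ^ k =
        ((Fintype.card K - 1 : ℕ) : ℂ_[p]) := by
      have : ∀ x, (ω⁻¹ ^ 1) x * ∑ k ∈ Finset.range f, ω x ^ p ^ k =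
          ∑ k ∈ Finset.range f, (ω ^ (p ^ k - 1)) x := by
        intro x
        rw [Finset.mul_sum]
        refine Finset.sum_congr rfl fun k _ => ?_
        by_cases hx : x = 0
        · rw [hx, (ω⁻¹ ^ 1).map_zero, zero_mul, (ω ^ (p ^ k - 1)).map_zero]
        · have h0 : ω x ≠ 0 := fun h => by simpa [h] using norm_mulChar ω hx
          have := MulChar.pow_apply_coe ω (p ^ k - 1) (Units.mk0 x hx)
          rw [Units.val_mk0] at this
          rw [inv_pow_apply _ _ hx, pow_one, this]
          have hk : p ^ k = (p ^ k - 1) + 1 := by have := Nat.pow_pos (n := k) hp.pos; lia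
          conv_lhs => rw [hk, pow_succ', inv_mul_cancel_left₀ h0]
      simp only [this]
      -- For `0 < k < f` the exponent `p ^ k - 1` lies strictly between 0 and `q - 1`, so the
      -- character is nontrivial and its sum vanishes.
      rw [Finset.sum_comm, Finset.sum_eq_single 0]
      · rw [pow_zero, Nat.sub_self, pow_zero, MulChar.sum_one_eq_card_units, Fintype.card_units]
      · intro k hk hk0
        refine MulChar.sum_eq_zero_of_ne_one fun h => ?_
        rw [hω.pow_eq_one_iff] at h
        have h1 := Nat.le_of_dvd (Nat.sub_pos_of_lt (Nat.one_lt_pow hk0 hp.one_lt)) h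
        have h2 := Nat.pow_lt_pow_right hp.one_lt (Finset.mem_range.1 hk)
        rw [hqf] at h1
        have := Nat.pow_pos (n := k) hp.pos
        lia
      · intro h
        exact absurd (Finset.mem_range.2 (Nat.pos_of_ne_zero hf0)) h
    rw [← hsum, ← Finset.sum_sub_distrib]
    refine sum_mem fun x _ => ?_
    rw [← mul_sub]
    exact mul_mem_openUnitBall (norm_mulChar_le _ _) (hc x)
  have hq1 : ‖((Fintype.card K - 1 : ℕ) : ℂ_[p])‖ = 1 := by
    refine norm_eq_of_sub_mem_openUnitBall (b := -1) ?_ (by simp)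
    rw [sub_neg_eq_add, ← Nat.cast_add_one, Nat.sub_add_cancel Fintype.card_pos, hqf,
      Nat.cast_pow, ← Nat.succ_pred_eq_of_ne_zero hf0, Nat.succ_eq_add_one, pow_succ]
    exact mul_mem_openUnitBall (by rw [← Nat.cast_pow]; exact norm_natCast_le_one _)
      prime_mem_openUnitBall
  rw [hg, norm_mul, norm_eq_of_sub_mem_openUnitBall hmain hq1, mul_one]

/-- The product of the two Gauss sums is the third times a Jacobi sum, which is integral. -/
lemma norm_teichGauss_mul_le {a b : ℕ} (hab : ¬ Fintype.card K - 1 ∣ a + b) :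
    ‖teichGauss hζ K a‖ * ‖teichGauss hζ K b‖ ≤ ‖teichGauss hζ K (a + b)‖ := by
  obtain ⟨ω, hω⟩ := exists_isTeichmuller p K
  rw [teichGauss_eq hζ hω, teichGauss_eq hζ hω, teichGauss_eq hζ hω, ← norm_mul,
    ← jacobiSum_mul_nontrivial, ← pow_add, norm_mul]
  · refine mul_le_of_le_one_right (norm_nonneg _) ?_
    refine IsUltrametricDist.norm_sum_le_of_forall_le_of_nonneg zero_le_one fun x _ => ?_
    rw [norm_mul]
    exact mul_le_one₀ (norm_mulChar_le _ _) (norm_nonneg _) (norm_mulChar_le _ _)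
  · rwa [← pow_add, Ne, teichmuller_inv_pow_eq_one_iff hω]

lemma norm_teichGauss_mul_sub {a : ℕ} (ha0 : a ≠ 0) (ha : a < Fintype.card K - 1) :
    ‖teichGauss hζ K a‖ * ‖teichGauss hζ K (Fintype.card K - 1 - a)‖ =
      ((p : ℝ) ^ Module.finrank (ZMod p) K)⁻¹ := by
  obtain ⟨ω, hω⟩ := exists_isTeichmuller p K
  have hχ : ω⁻¹ ^ a ≠ 1 := fun h => by
    have := Nat.le_of_dvd (Nat.pos_of_ne_zero ha0) ((teichmuller_inv_pow_eq_one_iff hω a).1 h)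
    lia
  have hinv : (ω⁻¹ ^ a)⁻¹ = ω⁻¹ ^ (Fintype.card K - 1 - a) := by
    refine inv_eq_of_mul_eq_one_right ?_
    rw [← pow_add, Nat.add_sub_cancel' ha.le, teichmuller_inv_pow_eq_one_iff hω]
  have h := gaussSum_mul_gaussSum_eq_card hχ
    (AddChar.IsPrimitive.of_ne_one (traceChar_ne_one hζ (K := K)))
  have h2 := mul_gaussSum_inv_eq_gaussSum (ω⁻¹ ^ a)⁻¹ (traceChar hζ K)
  rw [teichGauss_eq hζ hω, teichGauss_eq hζ hω, ← hinv, ← h2, norm_mul,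
    norm_mulChar _ (neg_ne_zero.2 one_ne_zero), one_mul, ← norm_mul, h, card_eq_pow_finrank_zmod (p := p) (K := K),
    Nat.cast_pow, norm_pow, norm_prime, inv_pow]

/-- **Stickelberger's theorem** on the valuation of Gauss sums. -/
theorem norm_teichGauss {a : ℕ} (ha : a < Fintype.card K - 1) :
    ‖teichGauss hζ K a‖ = (p : ℝ) ^ (-fracSum p (Module.finrank (ZMod p) K)
      (a / (Fintype.card K - 1 : ℕ))) := by
  have hp := (Fact.out : p.Prime)
  have hp0 : (0 : ℝ) < p := by exact_mod_cast hp.pos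
  have hqf : Fintype.card K = p ^ Module.finrank (ZMod p) K := card_eq_pow_finrank_zmod
  have hf0 : Module.finrank (ZMod p) K ≠ 0 := Module.finrank_pos.ne'
  have hπ : ‖ζ - 1‖ = (p : ℝ) ^ (-((p - 1 : ℕ) : ℝ)⁻¹) := by
    have hp1 : p - 1 ≠ 0 := Nat.sub_ne_zero_of_lt hp.one_lt
    rw [Real.rpow_neg hp0.le, ← Real.inv_rpow hp0.le, ← norm_zeta_sub_one_pow hζ,
      Real.pow_rpow_inv_natCast (norm_nonneg _) hp1]
  -- Induction on `a`. If `p ∣ a`, dividing by `p` changes neither side, by Frobenius invariance.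
  -- Otherwise, passing from `a - 1` to `a` raises the digit sum by exactly `1 / (p - 1)`, while the
  -- norm drops by at most the factor `‖ζ - 1‖`.
  have lower : ∀ a, a < Fintype.card K - 1 →
      (p : ℝ) ^ (-fracSum p (Module.finrank (ZMod p) K) (a / (Fintype.card K - 1 : ℕ))) ≤
        ‖teichGauss hζ K a‖ := by
    intro a
    induction a using Nat.strong_induction_on with
    | _ a ih =>
      intro ha
      rcases Nat.eq_zero_or_pos a with rfl | hpos
      · simp [teichGauss_zero, fracSum_zero]
      by_cases hpa : p ∣ a
      · obtain ⟨b, rfl⟩ := hpa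
        have hb : 0 < b := Nat.pos_of_mul_pos_left hpos
        have hlt : b < p * b := (Nat.lt_mul_iff_one_lt_left hb).2 hp.one_lt
        have := ih b hlt (hlt.trans ha)
        rw [teichGauss_mul_prime, hqf, fracSum_mul_prime hp.one_lt hf0]
        rwa [hqf] at this
      · obtain ⟨b, rfl⟩ := Nat.exists_eq_succ_of_ne_zero hpos.ne'
        have h1 := ih b (Nat.lt_succ_self b) (by lia)
        have h2 := norm_teichGauss_mul_le hζ (K := K) (a := b) (b := 1) (fun h => by
          have := Nat.le_of_dvd (Nat.succ_pos b) h; lia)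
        rw [norm_teichGauss_one hζ (by lia), hπ] at h2
        refine le_trans ?_ h2
        rw [hqf] at h1 ha ⊢
        rw [Nat.succ_eq_add_one, fracSum_succ hp.one_lt ha hpa, neg_add, Real.rpow_add hp0]
        gcongr
  -- The Gauss sums at `a` and `q - 1 - a` have product of norm `p ^ (-f)`, and the digit sums add
  -- up to `f`. The lower bound at `q - 1 - a` is thus an upper bound at `a`.
  refine le_antisymm ?_ (lower a ha)
  rcases Nat.eq_zero_or_pos a with rfl | hpos
  · simp [teichGauss_zero, fracSum_zero]
  have h1 := norm_teichGauss_mul_sub hζ hpos.ne' ha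
  have h2 := lower (Fintype.card K - 1 - a) (by lia)
  have h3 := fracSum_add_sub hp.one_lt hpos.ne' (hqf ▸ ha)
  rw [← hqf] at h3
  have hpos2 := Real.rpow_pos_of_pos hp0 (-fracSum p (Module.finrank (ZMod p) K)
    ((Fintype.card K - 1 - a : ℕ) / (Fintype.card K - 1 : ℕ)))
  rw [← eq_sub_iff_add_eq] at h3
  refine le_of_mul_le_mul_right ?_ hpos2
  rw [← Real.rpow_add hp0, ← neg_add, h3, sub_add_cancel, Real.rpow_neg hp0.le (Module.finrank (ZMod p) K : ℝ), Real.rpow_natCast,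
    ← h1]
  gcongr

/-- The Hasse–Davenport relation for powers of Teichmüller characters. -/
theorem teichGauss_extension {L : Type*} [Field L] [Fintype L] [Algebra (ZMod p) L] [Algebra K L]
    (a : ℕ) :
    -teichGauss hζ L (a * ((Fintype.card L - 1) / (Fintype.card K - 1))) =
      (-teichGauss hζ K a) ^ Module.finrank K L := by
  obtain ⟨ω, hω⟩ := exists_isTeichmuller p L
  obtain ⟨ω', hω', h⟩ := hω.comp_ringHom (algebraMap K L)
  have : IsScalarTower (ZMod p) K L := .of_algebraMap_eq' (Subsingleton.elim _ _)
  rw [teichGauss_eq hζ hω, teichGauss_eq hζ hω', ← hasseDavenport (L := L) _ (traceChar_ne_one hζ),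
    gaussSum]
  congr 1
  refine Finset.sum_congr rfl fun x _ => ?_
  rw [traceChar_apply, traceChar_apply, Algebra.trace_trace]
  congr 1
  by_cases hx : x = 0
  · rw [hx, Algebra.norm_zero, MulChar.map_zero, MulChar.map_zero]
  · have hn : Algebra.norm K x ≠ 0 := Algebra.norm_ne_zero_iff.2 hx
    rw [inv_pow_apply _ _ hx, inv_pow_apply _ _ hn, h, FiniteField.algebraMap_norm_eq_pow,
      Nat.card_eq_fintype_card, Nat.card_eq_fintype_card, map_pow, ← pow_mul, mul_comm a]

end Stickelberger

end DiagExpSum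

end

noncomputable section

namespace DiagExpSum

/-! ### The fundamental domain modulo the lattice and multiplication by `p` -/

section FracPoints

variable {n : ℕ}

/-- The index of the lattice spanned by the exponents. -/
def latticeIndex (w : Fin n → Fin n → ℤ) : ℕ := (expMatrix w).det.natAbs

/-- The points of the fundamental domain, through their coordinates in `(1/D)ℤ / ℤ ≃ ℤ/D`, where
`D` is the index of the lattice. -/
abbrev FracPoint (w : Fin n → Fin n → ℤ) : Type :=
  {b : Fin n → ZMod (latticeIndex w) // ∀ k, ∑ j, b j * (w j k : ZMod (latticeIndex w)) = 0}

/-- Multiplication of the coordinates by a unit. -/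
def mulPerm (w : Fin n → Fin n → ℤ) (u : (ZMod (latticeIndex w))ˣ) : Equiv.Perm (FracPoint w) where
  toFun b := ⟨fun j => u * b.1 j, fun k => by
    simp only [mul_assoc, ← Finset.mul_sum, b.2 k, mul_zero]⟩
  invFun b := ⟨fun j => u⁻¹ * b.1 j, fun k => by
    simp only [mul_assoc, ← Finset.mul_sum, b.2 k, mul_zero]⟩
  left_inv b := by ext j; simp
  right_inv b := by ext j; simp

lemma mulPerm_pow_apply (w : Fin n → Fin n → ℤ) (u : (ZMod (latticeIndex w))ˣ) (k : ℕ)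
    (b : FracPoint w) (j : Fin n) :
    (((mulPerm w u) ^ k) b).1 j = (u : ZMod (latticeIndex w)) ^ k * b.1 j := by
  induction k generalizing b with
  | zero => simp
  | succ k ih => rw [pow_succ, Equiv.Perm.mul_apply, ih, pow_succ, mul_assoc]; rfl

variable {w : Fin n → Fin n → ℤ} [NeZero (latticeIndex w)]

/-- The `j`-th coordinate, in `[0, 1)`, of a point of the fundamental domain. -/
def fracCoord (b : FracPoint w) (j : Fin n) : ℝ := ((b.1 j).val : ℝ) / latticeIndex w

omit [NeZero (latticeIndex w)] in
lemma fracCoord_nonneg (b : FracPoint w) (j : Fin n) : 0 ≤ fracCoord b j := by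
  unfold fracCoord; positivity

lemma fracCoord_lt_one (b : FracPoint w) (j : Fin n) : fracCoord b j < 1 := by
  have : (0 : ℝ) < latticeIndex w := by exact_mod_cast Nat.pos_of_ne_zero (NeZero.ne _)
  rw [fracCoord, div_lt_one this]
  exact_mod_cast ZMod.val_lt _

/-- The weight of a point of the fundamental domain. -/
def fracWeight (b : FracPoint w) : ℝ := ∑ j, fracCoord b j

variable {p : ℕ} (hcop : Nat.Coprime p (latticeIndex w))

/-- The action of `p` on the fundamental domain. -/
def frobPerm : Equiv.Perm (FracPoint w) := mulPerm w (ZMod.unitOfCoprime p hcop)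

omit [NeZero (latticeIndex w)] in
lemma frobPerm_pow_apply (k : ℕ) (b : FracPoint w) (j : Fin n) :
    (((frobPerm hcop) ^ k) b).1 j = (p : ZMod (latticeIndex w)) ^ k * b.1 j := by
  rw [frobPerm, mulPerm_pow_apply, ZMod.coe_unitOfCoprime]

lemma val_frobPerm_pow (k : ℕ) (b : FracPoint w) (j : Fin n) :
    ((((frobPerm hcop) ^ k) b).1 j).val = p ^ k * (b.1 j).val % latticeIndex w := by
  rw [frobPerm_pow_apply, ← ZMod.val_natCast]
  push_cast
  rw [ZMod.natCast_zmod_val]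

lemma fract_pow_mul_fracCoord (k : ℕ) (b : FracPoint w) (j : Fin n) :
    Int.fract ((p : ℝ) ^ k * fracCoord b j) = fracCoord (((frobPerm hcop) ^ k) b) j := by
  rw [fracCoord, fract_pow_mul_div, fracCoord, val_frobPerm_pow]

lemma sum_fracSum_fracCoord (f : ℕ) (b : FracPoint w) :
    ∑ j, fracSum p f (fracCoord b j) =
      ∑ k ∈ Finset.range f, fracWeight (((frobPerm hcop) ^ k) b) := by
  simp only [fracSum, fracWeight]
  rw [Finset.sum_comm]
  simp only [fract_pow_mul_fracCoord hcop]

/-- The exponent of the Teichmüller character of the field with `p ^ i` elements attached to a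
coordinate. -/
def charExp (p i : ℕ) (b : FracPoint w) (j : Fin n) : ℕ :=
  (p ^ i - 1) * (b.1 j).val / latticeIndex w

/-- Being fixed by `p ^ i` is what makes the natural number division in `charExp` exact. -/
lemma latticeIndex_dvd_of_fixed (hp : p ≠ 0) {i : ℕ} {b : FracPoint w}
    (hb : ((frobPerm hcop) ^ i) b = b) (j : Fin n) :
    latticeIndex w ∣ (p ^ i - 1) * (b.1 j).val := by
  rw [← ZMod.natCast_eq_zero_iff]
  have h := frobPerm_pow_apply hcop i b j
  rw [hb] at h
  rw [Nat.cast_mul, ZMod.natCast_zmod_val, Nat.cast_sub (Nat.one_le_pow _ _ (Nat.pos_of_ne_zero hp))]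
  push_cast
  rw [sub_mul, one_mul, ← h, sub_self]

lemma charExp_mul (hp : p ≠ 0) {i : ℕ} {b : FracPoint w}
    (hb : ((frobPerm hcop) ^ i) b = b) (j : Fin n) :
    charExp p i b j * latticeIndex w = (p ^ i - 1) * (b.1 j).val :=
  Nat.div_mul_cancel (latticeIndex_dvd_of_fixed hcop hp hb j)

lemma charExp_lt {i : ℕ} (hi : 1 < p ^ i) (b : FracPoint w) (j : Fin n) :
    charExp p i b j < p ^ i - 1 := by
  rw [charExp, Nat.div_lt_iff_lt_mul (Nat.pos_of_ne_zero (NeZero.ne _))]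
  exact Nat.mul_lt_mul_of_pos_left (ZMod.val_lt _) (by lia)

lemma charExp_div {i : ℕ} (hi : 1 < p ^ i) {b : FracPoint w}
    (hb : ((frobPerm hcop) ^ i) b = b) (j : Fin n) :
    (charExp p i b j : ℝ) / (p ^ i - 1 : ℕ) = fracCoord b j := by
  have hp : p ≠ 0 := by
    rintro rfl
    rcases Nat.eq_zero_or_pos i with rfl | h
    · simp at hi
    · simp [zero_pow h.ne'] at hi
  have h1 : ((p ^ i - 1 : ℕ) : ℝ) ≠ 0 := Nat.cast_ne_zero.2 (by lia)
  have h2 : (latticeIndex w : ℝ) ≠ 0 := Nat.cast_ne_zero.2 (NeZero.ne _)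
  rw [fracCoord, div_eq_div_iff h1 h2, mul_comm _ ((p ^ i - 1 : ℕ) : ℝ)]
  exact_mod_cast charExp_mul hcop hp hb j

omit [NeZero (latticeIndex w)] in
/-- By Cramer's rule the index kills the quotient of `ℤⁿ` by the lattice. -/
lemma dvd_mul_latticeIndex {N : ℤ} {a : Fin n → ℤ} (h : ∀ k, N ∣ ∑ j, a j * w j k) (j : Fin n) :
    N ∣ a j * latticeIndex w := by
  have h1 : (expMatrix w).adjugate.mulVec ((expMatrix w).mulVec a) = (expMatrix w).det • a := by
    rw [Matrix.mulVec_mulVec, Matrix.adjugate_mul, Matrix.smul_mulVec, Matrix.one_mulVec]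
  have h2 : N ∣ (expMatrix w).det * a j := by
    have := congrFun h1 j
    rw [Pi.smul_apply, smul_eq_mul] at this
    rw [← this]
    change N ∣ ∑ k, (expMatrix w).adjugate j k * (expMatrix w).mulVec a k
    refine Finset.dvd_sum fun k _ => Dvd.dvd.mul_left ?_ _
    have e : (expMatrix w).mulVec a k = ∑ j, a j * w j k := by
      simp only [Matrix.mulVec, dotProduct, expMatrix, Matrix.of_apply, mul_comm]
    exact e ▸ h k
  rw [latticeIndex, mul_comm]
  rcases Int.natAbs_eq (expMatrix w).det with h | h
  · rwa [← h]
  · rw [h, neg_mul, dvd_neg] at h2; exact h2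

/-- The exponents of the characters occurring in the exponential sum over the field with `p ^ i`
elements are the points of the fundamental domain fixed by `p ^ i`. -/
lemma sum_charExp (hp : p ≠ 0) {i : ℕ} (hi : 1 < p ^ i) {R : Type*} [AddCommMonoid R]
    (F : (Fin n → ℕ) → R) :
    ∑ a ∈ (Fintype.piFinset fun _ : Fin n => Finset.range (p ^ i - 1)) with
        ∀ k, ((p ^ i - 1 : ℕ) : ℤ) ∣ ∑ j, (a j : ℤ) * w j k, F a =
      ∑ b : FracPoint w with ((frobPerm hcop) ^ i) b = b, F (charExp p i b) := by
  set N := p ^ i - 1 with hN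
  set D := latticeIndex w with hD
  have hN0 : N ≠ 0 := by lia
  have hD0 : D ≠ 0 := NeZero.ne _
  symm
  refine Finset.sum_bij (fun b _ => charExp p i b) (fun b hb => ?_) (fun b hb b' hb' h => ?_)
    (fun a ha => ?_) (fun b hb => rfl)
  · have hfix := (Finset.mem_filter.1 hb).2
    simp only [Finset.mem_filter, Fintype.mem_piFinset, Finset.mem_range]
    refine ⟨fun j => charExp_lt hi b j, fun k => ?_⟩
    have h1 : (D : ℤ) ∣ ∑ j, ((b.1 j).val : ℤ) * w j k := by
      rw [← ZMod.intCast_zmod_eq_zero_iff_dvd]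
      push_cast
      simpa using b.2 k
    obtain ⟨e, he⟩ := h1
    refine ⟨e, mul_left_cancel₀ (Int.natCast_ne_zero.2 hD0) ?_⟩
    rw [mul_left_comm, ← he, Finset.mul_sum, Finset.mul_sum]
    refine Finset.sum_congr rfl fun j _ => ?_
    have := charExp_mul hcop hp hfix j
    rw [← mul_assoc, ← mul_assoc, mul_comm (D : ℤ)]
    congr 1
    exact_mod_cast this
  · have h1 := charExp_mul hcop hp (Finset.mem_filter.1 hb).2
    have h2 := charExp_mul hcop hp (Finset.mem_filter.1 hb').2
    refine Subtype.ext (funext fun j => ZMod.val_injective _ ?_)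
    refine Nat.eq_of_mul_eq_mul_left (Nat.pos_of_ne_zero hN0) ?_
    rw [← h1, ← h2, h]
  · simp only [Finset.mem_filter, Fintype.mem_piFinset, Finset.mem_range] at ha
    obtain ⟨hlt, hdvd⟩ := ha
    have hc : ∀ j, ∃ c : ℕ, a j * D = N * c := fun j => by
      have := dvd_mul_latticeIndex hdvd j
      exact_mod_cast this
    choose c hc using hc
    have hcD : ∀ j, c j < D := fun j => by
      refine Nat.lt_of_mul_lt_mul_left (a := N) ?_
      rw [← hc]
      exact Nat.mul_lt_mul_of_pos_right (hlt j) (Nat.pos_of_ne_zero hD0)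
    let b : FracPoint w := ⟨fun j => (c j : ZMod D), fun k => by
      have h1 : (D : ℤ) ∣ ∑ j, (c j : ℤ) * w j k := by
        obtain ⟨e, he⟩ := hdvd k
        refine ⟨e, mul_left_cancel₀ (Int.natCast_ne_zero.2 hN0) ?_⟩
        rw [mul_left_comm, ← he, Finset.mul_sum, Finset.mul_sum]
        refine Finset.sum_congr rfl fun j _ => ?_
        rw [← mul_assoc, ← mul_assoc, mul_comm (D : ℤ)]
        congr 1
        exact_mod_cast (hc j).symm
      rw [← ZMod.intCast_zmod_eq_zero_iff_dvd] at h1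
      push_cast at h1
      exact h1⟩
    have hval : ∀ j, (b.1 j).val = c j := fun j => ZMod.val_cast_of_lt (hcD j)
    refine ⟨b, Finset.mem_filter.2 ⟨Finset.mem_univ _, ?_⟩, ?_⟩
    · refine Subtype.ext (funext fun j => ?_)
      rw [frobPerm_pow_apply]
      have h1 : ((N * c j : ℕ) : ZMod D) = 0 := by rw [← hc]; simp
      have h2 : p ^ i = N + 1 := by lia
      rw [← Nat.cast_pow, h2, Nat.cast_add, add_mul, Nat.cast_one, one_mul, add_eq_right]
      rw [Nat.cast_mul] at h1
      exact h1
    · funext j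
      rw [charExp, hval, ← hN, ← hc, Nat.mul_div_cancel _ (Nat.pos_of_ne_zero hD0)]

end FracPoints

/-! ### Exponential sums as sums of products of Gauss sums -/

section ExpSum

variable {p : ℕ} [Fact p.Prime] {ζ : ℂ_[p]} (hζ : IsPrimitiveRoot ζ p) {n : ℕ}

lemma evalTorus_diagPoly (w : Fin n → Fin n → ℤ) {K : Type*} [Field K] [Algebra (ZMod p) K]
    (x : Fin n → Kˣ) :
    evalTorus (diagPoly p w) x = ∑ j, ((∏ k, x k ^ w j k : Kˣ) : K) := by
  classical
  have hadd : ∀ f g : AddMonoidAlgebra (ZMod p) (Fin n → ℤ),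
      evalTorus (f + g) x = evalTorus f x + evalTorus g x := fun f g => by
    simp only [evalTorus, AddMonoidAlgebra.coeff_add]
    exact Finsupp.sum_add_index' (fun _ => by simp) (fun _ _ _ => by rw [map_add, add_mul])
  have hzero : evalTorus (0 : AddMonoidAlgebra (ZMod p) (Fin n → ℤ)) x = 0 := by
    simp [evalTorus]
  have hsum : ∀ s : Finset (Fin n), evalTorus (∑ i ∈ s,
      (AddMonoidAlgebra.single (w i) 1 : AddMonoidAlgebra (ZMod p) (Fin n → ℤ))) x =
      ∑ j ∈ s, ((∏ k, x k ^ w j k : Kˣ) : K) := by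
    intro s
    induction s using Finset.induction_on with
    | empty => simpa using hzero
    | insert a s ha ih =>
      rw [Finset.sum_insert ha, Finset.sum_insert ha, hadd, ih]
      congr 1
      simp [evalTorus, AddMonoidAlgebra.coeff_single]
  exact hsum Finset.univ

variable {K : Type*} [Field K] [Fintype K] [Algebra (ZMod p) K]

/-- Fourier expansion of the additive character in terms of multiplicative characters. -/
lemma traceChar_fourier {ω : MulChar K ℂ_[p]} (hω : IsTeichmuller ω) (y : Kˣ) :
    ((Fintype.card K - 1 : ℕ) : ℂ_[p]) * traceChar hζ K y =
      ∑ a ∈ Finset.range (Fintype.card K - 1), ω y ^ a * teichGauss hζ K a := by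
  classical
  simp only [teichGauss_eq hζ hω, gaussSum, Finset.mul_sum]
  rw [Finset.sum_comm, Finset.sum_eq_single (y : K)]
  · have h0 : ω y ≠ 0 := fun h => by simpa [h] using norm_mulChar ω y.ne_zero
    rw [Finset.sum_congr rfl (g := fun _ => traceChar hζ K y)]
    · simp
    · intro a _
      rw [inv_pow_apply _ _ y.ne_zero, ← mul_assoc, mul_inv_cancel₀ (pow_ne_zero _ h0), one_mul]
  · intro z _ hz
    by_cases hz0 : z = 0
    · simp [hz0, MulChar.map_zero]
    have h1 : ω (y / z) ≠ 1 := fun h => by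
      rw [← map_one ω] at h
      have := hω.injective h
      rw [div_eq_one_iff_eq hz0] at this
      exact hz this.symm
    have h2 : ω (y / z) ^ (Fintype.card K - 1) = 1 := by
      rw [← map_pow, FiniteField.pow_card_sub_one_eq_one _ (div_ne_zero y.ne_zero hz0), map_one]
    have h3 : ∑ a ∈ Finset.range (Fintype.card K - 1), ω (y / z) ^ a = 0 := by
      have := mul_geom_sum (ω (y / z)) (Fintype.card K - 1)
      rw [h2, sub_self] at this
      exact (mul_eq_zero.1 this).resolve_left (sub_ne_zero.2 h1)
    calc _ = ∑ a ∈ Finset.range (Fintype.card K - 1), ω (y / z) ^ a * traceChar hζ K z := by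
          refine Finset.sum_congr rfl fun a _ => ?_
          rw [inv_pow_apply _ _ hz0, ← mul_assoc]
          congr 1
          have hd : ω (y / z) * ω z = ω y := by rw [← map_mul, div_mul_cancel₀ _ hz0]
          have h0 : ω z ≠ 0 := fun h => by simpa [h] using norm_mulChar ω hz0
          rw [← hd, mul_pow, mul_inv_cancel_right₀ (pow_ne_zero _ h0)]
      _ = 0 := by rw [← Finset.sum_mul, h3, zero_mul]
  · intro h; exact absurd (Finset.mem_univ _) h

variable [DecidableEq K]

omit [Algebra (ZMod p) K] in
/-- Orthogonality of characters on the torus. -/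
lemma sum_torus_teichmuller {ω : MulChar K ℂ_[p]} (hω : IsTeichmuller ω) (w : Fin n → Fin n → ℤ)
    (a : Fin n → ℕ) :
    ∑ x : Fin n → Kˣ, ∏ j, ω ((∏ k, x k ^ w j k : Kˣ) : K) ^ a j =
      if ∀ k, ((Fintype.card K - 1 : ℕ) : ℤ) ∣ ∑ j, (a j : ℤ) * w j k then
        ((Fintype.card K - 1 : ℕ) : ℂ_[p]) ^ n else 0 := by
  classical
  set θ : Kˣ →* ℂ_[p]ˣ := ω.toUnitHom
  have hθ : ∀ y : Kˣ, ω (y : K) = (θ y : ℂ_[p]) := fun y => (MulChar.coe_toUnitHom ω y).symm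
  have hprod : ∀ x : Fin n → Kˣ, ∏ j, ω ((∏ k, x k ^ w j k : Kˣ) : K) ^ a j =
      ∏ k, ((θ (x k) ^ (∑ j, (a j : ℤ) * w j k) : ℂ_[p]ˣ) : ℂ_[p]) := by
    intro x
    simp only [hθ]
    rw [← Units.coe_prod]
    simp only [← Units.val_pow_eq_pow_val]
    rw [← Units.coe_prod]
    congr 1
    have e1 : ∀ k, θ (x k) ^ (∑ j, (a j : ℤ) * w j k) = ∏ j, (θ (x k) ^ w j k) ^ a j := fun k => by
      have := map_sum (zmultiplesHom (Additive ℂ_[p]ˣ) (Additive.ofMul (θ (x k))))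
        (fun j => (a j : ℤ) * w j k) Finset.univ
      simp only [zmultiplesHom_apply, ← ofMul_zpow, ← ofMul_prod] at this
      rw [Additive.ofMul.injective this]
      exact Finset.prod_congr rfl fun j _ => by rw [mul_comm, zpow_mul, zpow_natCast]
    simp only [e1]
    rw [Finset.prod_comm]
    refine Finset.prod_congr rfl fun j _ => ?_
    rw [map_prod, ← Finset.prod_pow]
    simp only [map_zpow]
  simp only [hprod]
  rw [← Fintype.piFinset_univ, ← Finset.prod_univ_sum (fun _ => Finset.univ)
    (fun k (y : Kˣ) => ((θ y ^ (∑ j, (a j : ℤ) * w j k) : ℂ_[p]ˣ) : ℂ_[p]))]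
  have hone : ∀ c : ℤ, (∀ y, θ y ^ c = 1) ↔ ((Fintype.card K - 1 : ℕ) : ℤ) ∣ c := by
    intro c
    have hinj : Function.Injective θ := fun y z h => Units.ext (hω.injective (by
      rw [hθ, hθ, h]))
    rw [← Fintype.card_units, ← Nat.card_eq_fintype_card,
      ← IsCyclic.exponent_eq_card (α := Kˣ), Int.natCast_dvd,
      Monoid.exponent_dvd_iff_forall_pow_eq_one]
    refine forall_congr' fun y => ?_
    rw [pow_natAbs_eq_one, ← map_zpow, ← map_one θ, hinj.eq_iff]
  have hfac : ∀ c : ℤ, ∑ y : Kˣ, ((θ y ^ c : ℂ_[p]ˣ) : ℂ_[p]) =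
      if ((Fintype.card K - 1 : ℕ) : ℤ) ∣ c then ((Fintype.card K - 1 : ℕ) : ℂ_[p]) else 0 := by
    intro c
    split_ifs with h
    · rw [← hone] at h
      simp [h, Fintype.card_units]
    · have := sum_hom_units_eq_zero ((Units.coeHom ℂ_[p]).comp (θ ^ c)) (fun h' => h ?_)
      · exact this
      · rw [← hone]
        intro y
        exact Units.ext (DFunLike.congr_fun h' y)
  simp only [hfac]
  split_ifs with h
  · rw [Finset.prod_congr rfl fun k _ => if_pos (h k)]
    simp
  · push Not at h
    obtain ⟨k, hk⟩ := h
    exact Finset.prod_eq_zero (Finset.mem_univ k) (if_neg hk)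

/-- Multiply by `(q - 1) ^ n`, `q = |K|`, expand each of the `n` factors by `traceChar_fourier`, and
sum over the torus first. Orthogonality keeps the exponents `a` with `∑ a_j w_j ≡ 0` modulo `q - 1`
and gives back the factor `(q - 1) ^ n`. -/
lemma sum_torus_traceChar (w : Fin n → Fin n → ℤ) :
    ∑ x : Fin n → Kˣ, traceChar hζ K (evalTorus (diagPoly p w) x) =
      ∑ a ∈ (Fintype.piFinset fun _ : Fin n => Finset.range (Fintype.card K - 1)) with
        ∀ k, ((Fintype.card K - 1 : ℕ) : ℤ) ∣ ∑ j, (a j : ℤ) * w j k,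
        ∏ j, teichGauss hζ K (a j) := by
  classical
  obtain ⟨ω, hω⟩ := exists_isTeichmuller p K
  set N := Fintype.card K - 1
  have hN : (N : ℂ_[p]) ^ n ≠ 0 :=
    pow_ne_zero _ (Nat.cast_ne_zero.2 (Nat.sub_ne_zero_of_lt Fintype.one_lt_card))
  refine mul_left_cancel₀ hN ?_
  calc _ = ∑ x : Fin n → Kˣ, ∑ a ∈ Fintype.piFinset fun _ : Fin n => Finset.range N,
        ∏ j, (ω ((∏ k, x k ^ w j k : Kˣ) : K) ^ a j * teichGauss hζ K (a j)) := by
        rw [Finset.mul_sum]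
        refine Finset.sum_congr rfl fun x _ => ?_
        rw [← Finset.prod_univ_sum (fun _ => Finset.range N)
          (fun j a => ω ((∏ k, x k ^ w j k : Kˣ) : K) ^ a * teichGauss hζ K a)]
        simp only [← traceChar_fourier hζ hω, Finset.prod_mul_distrib, N]
        rw [evalTorus_diagPoly]
        have := map_prod (traceChar hζ K).toMonoidHom
          (fun j => Multiplicative.ofAdd ((∏ k, x k ^ w j k : Kˣ) : K)) Finset.univ
        rw [← ofAdd_sum] at this
        rw [Finset.prod_const, Finset.card_univ, Fintype.card_fin]
        exact congrArg _ this
    _ = _ := by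
        rw [Finset.sum_comm, Finset.sum_filter, Finset.mul_sum]
        refine Finset.sum_congr rfl fun a _ => ?_
        simp only [Finset.prod_mul_distrib]
        rw [← Finset.sum_mul, sum_torus_teichmuller hω]
        split_ifs <;> simp [N]

/-- The product of Gauss sums attached to a point of the fundamental domain. -/
def gaussProd (w : Fin n → Fin n → ℤ) (i : ℕ) [Fintype (GaloisField p i)] (b : FracPoint w) :
    ℂ_[p] :=
  ∏ j, teichGauss hζ (GaloisField p i) (charExp p i b j)

instance fintypeGaloisField (p : ℕ) [Fact p.Prime] (i : ℕ) : Fintype (GaloisField p i) :=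
  Fintype.ofFinite _

lemma card_galoisField {i : ℕ} (hi : i ≠ 0) : Fintype.card (GaloisField p i) = p ^ i := by
  rw [← Nat.card_eq_fintype_card, GaloisField.card p i hi]

theorem expSum_eq_sum_gaussProd {w : Fin n → Fin n → ℤ} [NeZero (latticeIndex w)]
    (hcop : Nat.Coprime p (latticeIndex w)) {i : ℕ} (hi : i ≠ 0) :
    expSum p ζ (diagPoly p w) i =
      ∑ b : FracPoint w with ((frobPerm hcop) ^ i) b = b, gaussProd hζ w i b := by
  classical
  have hp := (Fact.out : p.Prime)
  rw [expSum, finsum_eq_sum_of_fintype]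
  have h := sum_torus_traceChar hζ (K := GaloisField p i) w
  rw [card_galoisField hi, sum_charExp hcop hp.ne_zero (Nat.one_lt_pow hi hp.one_lt)
    (fun a => ∏ j, teichGauss hζ (GaloisField p i) (a j))] at h
  exact h

end ExpSum

end DiagExpSum

end

noncomputable section

namespace DiagExpSum

/-! ### Orbits of a permutation of a finite set -/

section Orbits

variable {B : Type*} [Fintype B] (T : Equiv.Perm B)

/-- The set of orbits of a permutation. -/
abbrev Orbits : Type _ := Quotient (Equiv.Perm.SameCycle.setoid T)

instance : Fintype (Orbits T) := Fintype.ofFinite _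

/-- A point of an orbit. -/
def orbitPoint (o : Orbits T) : B := Quotient.out o

/-- The length of an orbit. -/
def orbitLength (o : Orbits T) : ℕ := Function.minimalPeriod T (orbitPoint T o)

variable {T}

omit [Fintype B] in
lemma perm_pow_apply_eq_iterate (k : ℕ) (b : B) : (T ^ k) b = T^[k] b := by
  rw [Equiv.Perm.iterate_eq_pow]

lemma orbitLength_pos (o : Orbits T) : 0 < orbitLength T o :=
  Function.minimalPeriod_pos_of_mem_periodicPts
    (Function.Injective.mem_periodicPts T.injective _)

omit [Fintype B] in
lemma pow_orbitPoint_eq_iff (o : Orbits T) (i : ℕ) :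
    (T ^ i) (orbitPoint T o) = orbitPoint T o ↔ orbitLength T o ∣ i := by
  rw [perm_pow_apply_eq_iterate]
  exact Function.isPeriodicPt_iff_minimalPeriod_dvd

lemma exists_orbitPoint (b : B) : ∃ o : Orbits T, ∃ k < orbitLength T o,
    (T ^ k) (orbitPoint T o) = b := by
  set o : Orbits T := Quotient.mk _ b with ho
  have h : T.SameCycle (orbitPoint T o) b := Quotient.exact (Quotient.out_eq o)
  obtain ⟨k, hk⟩ := h.exists_nat_pow_eq
  refine ⟨o, k % orbitLength T o, Nat.mod_lt _ (orbitLength_pos o), ?_⟩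
  rw [perm_pow_apply_eq_iterate] at hk ⊢
  rw [orbitLength, Function.iterate_mod_minimalPeriod_eq, hk]

/-- Summation along the orbits of a permutation. -/
lemma sum_orbits {M : Type*} [AddCommMonoid M] (F : B → M) :
    ∑ b, F b = ∑ o : Orbits T, ∑ k ∈ Finset.range (orbitLength T o),
      F ((T ^ k) (orbitPoint T o)) := by
  rw [Finset.sum_sigma']
  symm
  refine Finset.sum_bij (fun x _ => (T ^ x.2) (orbitPoint T x.1)) (fun _ _ => Finset.mem_univ _)
    ?_ (fun b _ => ?_) (fun _ _ => rfl)
  · rintro ⟨o, k⟩ h ⟨o', k'⟩ h' hkk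
    simp only [Finset.mem_sigma, Finset.mem_univ, true_and, Finset.mem_range] at h h' hkk
    have ho : o = o' := by
      rw [← Quotient.out_eq o, ← Quotient.out_eq o']
      refine Quotient.sound ?_
      have h1 : T.SameCycle (orbitPoint T o) ((T ^ k) (orbitPoint T o)) := ⟨k, by simp⟩
      have h2 : T.SameCycle (orbitPoint T o') ((T ^ k') (orbitPoint T o')) := ⟨k', by simp⟩
      exact h1.trans (hkk ▸ h2.symm)
    subst ho
    rw [perm_pow_apply_eq_iterate, perm_pow_apply_eq_iterate] at hkk
    have := Function.iterate_injOn_Iio_minimalPeriod (f := T) (x := orbitPoint T o) h h' hkk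
    rw [this]
  · obtain ⟨o, k, hk, hb⟩ := exists_orbitPoint (T := T) b
    exact ⟨⟨o, k⟩, by simpa using hk, hb⟩

/-- An orbit is fixed pointwise by `T ^ i` when its length divides `i`, and contains no fixed point
of `T ^ i` otherwise. -/
lemma sum_fixed_eq_sum_orbits [DecidableEq B] {M : Type*} [AddCommMonoid M] (i : ℕ) (F : B → M)
    (hF : ∀ b, (T ^ i) b = b → F (T b) = F b) :
    ∑ b with (T ^ i) b = b, F b = ∑ o : Orbits T,
      if orbitLength T o ∣ i then orbitLength T o • F (orbitPoint T o) else 0 := by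
  rw [Finset.sum_filter, sum_orbits (T := T)]
  refine Finset.sum_congr rfl fun o _ => ?_
  have hiff : ∀ k, (T ^ i) ((T ^ k) (orbitPoint T o)) = (T ^ k) (orbitPoint T o) ↔
      orbitLength T o ∣ i := by
    intro k
    rw [← pow_orbitPoint_eq_iff, ← Equiv.Perm.mul_apply, ← pow_add, add_comm, pow_add,
      Equiv.Perm.mul_apply, (T ^ k).injective.eq_iff]
  simp only [hiff]
  split_ifs with h
  · have hk : ∀ k, F ((T ^ k) (orbitPoint T o)) = F (orbitPoint T o) := by
      intro k
      induction k with
      | zero => simp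
      | succ k ih =>
        rw [pow_succ', Equiv.Perm.mul_apply, hF _ ((hiff k).2 h), ih]
    simp [hk]
  · simp

end Orbits

/-! ### Logarithmic derivatives of power series -/

section LogDerivative

open PowerSeries

variable {F : Type*} [Field F]

/-- The logarithmic derivative of `1 - h X ^ d` is `-∑ d h ^ m X ^ (d m - 1)`, `m ≥ 1`; the index is
`k + 1 = d m`. -/
lemma derivative_one_sub_C_mul_X_pow (h : F) {d : ℕ} (hd : 0 < d) :
    derivative F (1 - C h * X ^ d) =
      (mk fun k => -(if d ∣ k + 1 then (d : F) * h ^ ((k + 1) / d) else 0)) *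
        (1 - C h * X ^ d) := by
  ext k
  rw [coeff_derivative, mul_sub, mul_one, map_sub, map_sub, coeff_one, if_neg (by lia), mul_left_comm,
    coeff_C_mul, coeff_C_mul, coeff_X_pow, coeff_mul_X_pow', coeff_mk]
  by_cases hk : d ≤ k
  · rw [if_pos hk, coeff_mk, if_neg (by lia)]
    have h1 : d ∣ k - d + 1 ↔ d ∣ k + 1 := by
      rw [show k + 1 = k - d + 1 + d by lia, Nat.dvd_add_self_right]
    rw [if_congr h1 rfl rfl]
    split_ifs with hdv
    · have h2 : (k + 1) / d = (k - d + 1) / d + 1 := by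
        rw [show k + 1 = k - d + 1 + d by lia, Nat.add_div_right _ hd]
      rw [h2]; ring
    · ring
  · rw [if_neg hk]
    by_cases hk' : k + 1 = d
    · subst hk'
      rw [if_pos rfl, if_pos dvd_rfl, Nat.div_self hd]
      push_cast; ring
    · rw [if_neg (by lia), if_neg (fun hdv => hk' ?_)]
      · ring
      · exact le_antisymm (by lia) (Nat.le_of_dvd (Nat.succ_pos k) hdv)

lemma derivative_prod_eq {ι : Type*} (s : Finset ι) (f a : ι → PowerSeries F)
    (h : ∀ i ∈ s, derivative F (f i) = a i * f i) :
    derivative F (∏ i ∈ s, f i) = (∑ i ∈ s, a i) * ∏ i ∈ s, f i := by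
  classical
  induction s using Finset.induction_on with
  | empty => simp
  | insert j s hj ih =>
    rw [Finset.prod_insert hj, Finset.sum_insert hj, Derivation.leibniz, smul_eq_mul, smul_eq_mul,
      ih fun i hi => h i (Finset.mem_insert_of_mem hi), h j (Finset.mem_insert_self j s)]
    ring

lemma mul_eq_one_of_derivative [CharZero F] {f g a : PowerSeries F}
    (hf : derivative F f = a * f) (hg : derivative F g = -a * g)
    (hf0 : constantCoeff f = 1) (hg0 : constantCoeff g = 1) : f * g = 1 := by
  refine derivative.ext ?_ ?_
  · rw [Derivation.leibniz, smul_eq_mul, smul_eq_mul, hf, hg, derivative_one]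
    ring
  · rw [map_mul, hf0, hg0, mul_one, map_one]

lemma exp_subst_derivative [CharZero F] {A : PowerSeries F} (hA : constantCoeff A = 0) :
    derivative F ((exp F).subst A) = derivative F A * (exp F).subst A ∧
      constantCoeff ((exp F).subst A) = 1 := by
  have hs : HasSubst A := HasSubst.of_constantCoeff_zero' hA
  refine ⟨?_, ?_⟩
  · rw [derivative_subst hs, derivative_exp, mul_comm]
  · rw [← coeff_zero_eq_constantCoeff_apply, coeff_subst' hs, finsum_eq_single _ 0]
    · simp
    · intro d hd
      rw [coeff_zero_eq_constantCoeff_apply, map_pow, hA, zero_pow hd, smul_zero]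

end LogDerivative

/-! ### The L-function as a product over orbits -/

section LFunction

variable {p : ℕ} [Fact p.Prime] {ζ : ℂ_[p]} (hζ : IsPrimitiveRoot ζ p) {n : ℕ}
  {w : Fin n → Fin n → ℤ}

/-- The product of the negatives of the Gauss sums attached to a point of the fundamental
domain. -/
def frobEigen (w : Fin n → Fin n → ℤ) (i : ℕ) (b : FracPoint w) : ℂ_[p] :=
  ∏ j, -teichGauss hζ (GaloisField p i) (charExp p i b j)

variable [NeZero (latticeIndex w)] (hcop : Nat.Coprime p (latticeIndex w))

/-- Hasse–Davenport is a statement about `-g`, with `g` the Gauss sum. Negating all `n` factors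
produces the sign that the exponent `(-1) ^ (n - 1)` compensates. -/
lemma expSum_eq_sum_frobEigen {i : ℕ} (hi : i ≠ 0) :
    expSum p ζ (diagPoly p w) i =
      (-1) ^ n * ∑ b : FracPoint w with ((frobPerm hcop) ^ i) b = b, frobEigen hζ w i b := by
  rw [expSum_eq_sum_gaussProd hζ hcop hi, Finset.mul_sum]
  refine Finset.sum_congr rfl fun b _ => ?_
  rw [frobEigen, gaussProd, Finset.prod_neg, Finset.card_univ, Fintype.card_fin, ← mul_assoc,
    ← mul_pow]
  simp

lemma teichGauss_add_mul {K : Type*} [Field K] [Fintype K] [Algebra (ZMod p) K] (a c : ℕ) :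
    teichGauss hζ K (a + (Fintype.card K - 1) * c) = teichGauss hζ K a := by
  obtain ⟨ω, hω⟩ := exists_isTeichmuller p K
  rw [teichGauss_eq hζ hω, teichGauss_eq hζ hω, pow_add,
    (teichmuller_inv_pow_eq_one_iff hω _).2 (dvd_mul_right _ _), mul_one]

/-- Up to multiples of `p ^ i - 1`, the exponent at the image of `b` is `p` times that at `b`, and
Frobenius leaves the Gauss sums unchanged. -/
lemma frobEigen_frobPerm {i : ℕ} (hi : i ≠ 0) {b : FracPoint w}
    (hb : ((frobPerm hcop) ^ i) b = b) :
    frobEigen hζ w i (frobPerm hcop b) = frobEigen hζ w i b := by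
  have hp := (Fact.out : p.Prime)
  have hb' : ((frobPerm hcop) ^ i) (frobPerm hcop b) = frobPerm hcop b := by
    rw [← Equiv.Perm.mul_apply, ← pow_succ, pow_succ', Equiv.Perm.mul_apply, hb]
  refine Finset.prod_congr rfl fun j _ => ?_
  congr 1
  rw [← teichGauss_mul_prime hζ (charExp p i b j),
    ← teichGauss_add_mul hζ _ (p * (b.1 j).val / latticeIndex w), card_galoisField hi]
  congr 1
  refine Nat.eq_of_mul_eq_mul_right (Nat.pos_of_ne_zero (NeZero.ne (latticeIndex w))) ?_
  rw [add_mul, charExp_mul hcop hp.ne_zero hb', mul_assoc p, charExp_mul hcop hp.ne_zero hb,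
    mul_assoc, ← mul_add]
  have h := val_frobPerm_pow hcop 1 b j
  rw [pow_one, pow_one] at h
  rw [h, mul_comm (p * _ / _), Nat.mod_add_div]
  ring

/-- Passing from level `d` to `d * m` multiplies each exponent by `(p ^ (d m) - 1) / (p ^ d - 1)`.
This is composition of the character with the norm, so Hasse–Davenport applies factor by factor. -/
lemma frobEigen_mul {d m : ℕ} (hd : d ≠ 0) (hm : m ≠ 0) {b : FracPoint w}
    (hb : ((frobPerm hcop) ^ d) b = b) :
    frobEigen hζ w (d * m) b = frobEigen hζ w d b ^ m := by
  have hp := (Fact.out : p.Prime)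
  have hdm : d * m ≠ 0 := mul_ne_zero hd hm
  obtain ⟨φ⟩ : Nonempty (GaloisField p d →ₐ[ZMod p] GaloisField p (d * m)) := by
    refine FiniteField.nonempty_algHom_of_finrank_dvd ?_
    rw [GaloisField.finrank p hd, GaloisField.finrank p hdm]
    exact dvd_mul_right d m
  let _ : Algebra (GaloisField p d) (GaloisField p (d * m)) := φ.toRingHom.toAlgebra
  have hrank : Module.finrank (GaloisField p d) (GaloisField p (d * m)) = m := by
    have h := Module.card_eq_pow_finrank (K := GaloisField p d) (V := GaloisField p (d * m))
    rw [card_galoisField hd, card_galoisField hdm, ← pow_mul] at h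
    exact (Nat.eq_of_mul_eq_mul_left (Nat.pos_of_ne_zero hd)
      (Nat.pow_right_injective hp.two_le h)).symm
  rw [frobEigen, frobEigen, ← Finset.prod_pow]
  refine Finset.prod_congr rfl fun j _ => ?_
  have h := teichGauss_extension hζ (K := GaloisField p d) (L := GaloisField p (d * m))
    (charExp p d b j)
  rw [hrank, card_galoisField hd, card_galoisField hdm] at h
  rw [← h]
  congr 2
  have hdvd : p ^ d - 1 ∣ p ^ (d * m) - 1 := by
    rw [pow_mul]
    exact Nat.sub_one_dvd_pow_sub_one (p ^ d) m
  obtain ⟨e, he⟩ := hdvd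
  have h1 : 0 < p ^ d - 1 := Nat.sub_pos_of_lt (Nat.one_lt_pow hd hp.one_lt)
  rw [he, Nat.mul_div_cancel_left _ h1, charExp, charExp, he, mul_assoc, mul_comm e, ← mul_assoc]
  obtain ⟨c, hc⟩ := latticeIndex_dvd_of_fixed hcop hp.ne_zero hb j
  have hD := Nat.pos_of_ne_zero (NeZero.ne (latticeIndex w))
  rw [hc, mul_assoc, Nat.mul_div_cancel_left _ hD, Nat.mul_div_cancel_left _ hD]

/-- Stickelberger's theorem for each coordinate; exchanging the sums over coordinates and over
powers of `p` turns digit sums into weights along the orbit. -/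
lemma norm_frobEigen {d : ℕ} (hd : d ≠ 0) {b : FracPoint w} (hb : ((frobPerm hcop) ^ d) b = b) :
    ‖frobEigen hζ w d b‖ =
      (p : ℝ) ^ (-∑ k ∈ Finset.range d, fracWeight (((frobPerm hcop) ^ k) b)) := by
  have hp := (Fact.out : p.Prime)
  have h1 := Nat.one_lt_pow hd hp.one_lt
  rw [← sum_fracSum_fracCoord, ← Finset.sum_neg_distrib,
    Real.rpow_sum_of_pos (by exact_mod_cast hp.pos), frobEigen, norm_prod]
  refine Finset.prod_congr rfl fun j _ => ?_
  rw [norm_neg, norm_teichGauss hζ (by rw [card_galoisField hd]; exact charExp_lt h1 b j),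
    card_galoisField hd, GaloisField.finrank p hd, charExp_div hcop h1 hb]

/-- The L-function is a polynomial, a product of one factor for each orbit of the fundamental
domain under multiplication by `p`. -/
def orbitPoly : Polynomial ℂ_[p] :=
  ∏ o : Orbits (frobPerm hcop), (1 - Polynomial.C (frobEigen hζ w (orbitLength _ o)
    (orbitPoint _ o)) * Polynomial.X ^ orbitLength _ o)

open PowerSeries in
-- Both sides have constant term 1 and the same logarithmic derivative. An orbit of length `d`
-- contributes to the coefficient of index `k` exactly when `d ∣ k + 1`, and then through a power of
-- its eigenvalue by `frobEigen_mul`.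
theorem LFunctionSigned_eq_orbitPoly :
    LFunctionSigned p ζ (diagPoly p w) = (orbitPoly hζ hcop : PowerSeries ℂ_[p]) := by
  classical
  set T := frobPerm hcop
  set S : ℕ → ℂ_[p] := fun i => ∑ b : FracPoint w with (T ^ i) b = b, frobEigen hζ w i b with hS
  set P : PowerSeries ℂ_[p] := (orbitPoly hζ hcop : PowerSeries ℂ_[p]) with hP
  have hPprod : P = ∏ o : Orbits T, (1 - C (frobEigen hζ w (orbitLength _ o)
      (orbitPoint _ o)) * X ^ orbitLength _ o) := by
    rw [hP, orbitPoly, ← Polynomial.coeToPowerSeries.ringHom_apply, map_prod]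
    simp [T]
  have hPd : derivative ℂ_[p] P = (mk fun k => -S (k + 1)) * P := by
    rw [hPprod, derivative_prod_eq _ _ _ fun o _ =>
      derivative_one_sub_C_mul_X_pow _ (orbitLength_pos o)]
    congr 1
    ext k
    rw [map_sum, coeff_mk, hS]
    simp only [coeff_mk]
    rw [sum_fixed_eq_sum_orbits (T := T) (k + 1) (frobEigen hζ w (k + 1))
      (fun b hb => frobEigen_frobPerm hζ hcop (Nat.succ_ne_zero k) hb), ← Finset.sum_neg_distrib]
    refine Finset.sum_congr rfl fun o _ => ?_
    congr 1
    split_ifs with h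
    · rw [nsmul_eq_mul]
      congr 1
      have hd := orbitLength_pos o
      obtain ⟨m, hm⟩ := h
      have hm0 : m ≠ 0 := by rintro rfl; simp at hm
      rw [hm, Nat.mul_div_cancel_left _ hd, frobEigen_mul hζ hcop hd.ne' hm0
        ((pow_orbitPoint_eq_iff o _).2 dvd_rfl)]
    · rfl
  have hP0 : constantCoeff P = 1 := by
    rw [hPprod, map_prod]
    refine Finset.prod_eq_one fun o _ => ?_
    simp [(orbitLength_pos o).ne']
  obtain ⟨hL, hL0⟩ := exp_subst_derivative
    (A := mk fun i => if i = 0 then (0 : ℂ_[p]) else expSum p ζ (diagPoly p w) i / (i : ℂ_[p]))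
    (by simp)
  have hA : derivative ℂ_[p]
      (mk fun i => if i = 0 then (0 : ℂ_[p]) else expSum p ζ (diagPoly p w) i / (i : ℂ_[p])) =
      mk fun k => (-1) ^ n * S (k + 1) := by
    ext k
    rw [coeff_derivative, coeff_mk, coeff_mk, if_neg (Nat.succ_ne_zero k),
      expSum_eq_sum_frobEigen hζ hcop (Nat.succ_ne_zero k), ← Nat.cast_add_one,
      div_mul_cancel₀ _ (Nat.cast_ne_zero.2 (Nat.succ_ne_zero k))]
  rw [hA] at hL
  rw [LFunctionSigned]
  change _ = P
  split_ifs with hn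
  · have hL' : derivative ℂ_[p] (LFunction p ζ (diagPoly p w)) =
        (mk fun k => -S (k + 1)) * LFunction p ζ (diagPoly p w) := by
      rw [LFunction, hL]
      simp [hn.neg_one_pow]
    have hc : constantCoeff (LFunction p ζ (diagPoly p w)) ≠ 0 := by
      rw [LFunction, hL0]; exact one_ne_zero
    have hinv : derivative ℂ_[p] (LFunction p ζ (diagPoly p w))⁻¹ =
        -(mk fun k => -S (k + 1)) * (LFunction p ζ (diagPoly p w))⁻¹ := by
      rw [derivative_inv', hL', pow_two, neg_mul, neg_mul, mul_left_comm, mul_assoc,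
        PowerSeries.inv_mul_cancel _ hc, mul_one]
    have h1 := mul_eq_one_of_derivative hPd hinv hP0
      (by rw [PowerSeries.constantCoeff_inv, LFunction, hL0, inv_one])
    rw [← mul_one (LFunction p ζ (diagPoly p w)), ← h1, mul_left_comm,
      PowerSeries.mul_inv_cancel _ hc, mul_one]
  · have hL' : derivative ℂ_[p] (LFunction p ζ (diagPoly p w)) =
        -(mk fun k => -S (k + 1)) * LFunction p ζ (diagPoly p w) := by
      rw [LFunction, hL]
      have : (-1 : ℂ_[p]) ^ n = 1 := (Nat.not_odd_iff_even.1 hn).neg_one_pow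
      congr 1
      ext k
      simp [this]
    have h1 := mul_eq_one_of_derivative hPd hL' hP0 hL0
    exact ((PowerSeries.eq_inv_iff_mul_eq_one (by rw [LFunction, hL0]; exact one_ne_zero)).2
      h1).symm

end LFunction

end DiagExpSum

end

noncomputable section

namespace DiagExpSum

/-! ### Lower convex hulls and supporting lines -/

section LowerHull

open scoped Pointwise

variable {P Q : Set (ℝ × ℝ)}

lemma convexHull_subset_halfPlane {s c : ℝ} (h : ∀ x ∈ P, c ≤ x.2 - s * x.1) {x : ℝ × ℝ}
    (hx : x ∈ convexHull ℝ P) : c ≤ x.2 - s * x.1 := by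
  have hconv : Convex ℝ {x : ℝ × ℝ | c ≤ x.2 - s * x.1} := by
    refine convex_halfSpace_ge (f := fun x : ℝ × ℝ => x.2 - s * x.1) ⟨fun x y => ?_, fun a x => ?_⟩ c
    · simp only [Prod.fst_add, Prod.snd_add]; ring
    · simp only [Prod.smul_fst, Prod.smul_snd, smul_eq_mul]; ring
  exact convexHull_min (t := {x : ℝ × ℝ | c ≤ x.2 - s * x.1}) h hconv hx

/-- Finiteness makes the hull compact, so below each point of `P` there is a lowest point of the
hull, and it lies in `lowerHull P`. -/
lemma halfPlane_lowerHull_iff (hP : P.Finite) (s c : ℝ) :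
    (∀ x ∈ P, c ≤ x.2 - s * x.1) ↔ ∀ x ∈ lowerHull P, c ≤ x.2 - s * x.1 := by
  constructor
  · intro h x hx
    exact convexHull_subset_halfPlane h hx.1
  · intro h x hx
    have hK : IsCompact (convexHull ℝ P ∩ Prod.fst ⁻¹' {x.1}) :=
      (hP.isCompact_convexHull ℝ).inter_right (isClosed_singleton.preimage continuous_fst)
    have hxK : x ∈ convexHull ℝ P ∩ Prod.fst ⁻¹' {x.1} := ⟨subset_convexHull ℝ P hx, rfl⟩
    obtain ⟨y, ⟨hy1, hy2⟩, hmin⟩ := hK.exists_isMinOn ⟨x, hxK⟩ continuous_snd.continuousOn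
    have hy2 : y.1 = x.1 := hy2
    have h1 := h y ⟨hy1, fun z hz => hmin (a := (y.1, z)) ⟨hz, hy2⟩⟩
    have h2 : y.2 ≤ x.2 := hmin hxK
    rw [hy2] at h1
    linarith

/-- Otherwise Hahn–Banach separates `q` from the hull of `P` thickened by the upward ray. The upward
ray forces `β ≥ 0`. The separating line, made non-vertical, gives a half-plane containing `P`, hence
`Q`, but not `q`. -/
lemma exists_below (hP : P.Finite) (hne : P.Nonempty)
    (h : ∀ s c : ℝ, (∀ x ∈ P, c ≤ x.2 - s * x.1) → ∀ x ∈ Q, c ≤ x.2 - s * x.1) {q : ℝ × ℝ}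
    (hq : q ∈ convexHull ℝ Q) : ∃ y ∈ convexHull ℝ P, y.1 = q.1 ∧ y.2 ≤ q.2 := by
  by_contra! hno
  set R : Set (ℝ × ℝ) := {0} ×ˢ Set.Ici 0 with hR
  have hclosed : IsClosed (convexHull ℝ P + R) :=
    (isClosed_singleton.prod isClosed_Ici).add_left_of_isCompact (hP.isCompact_convexHull ℝ)
  have hconv : Convex ℝ (convexHull ℝ P + R) :=
    (convex_convexHull ℝ P).add ((convex_singleton 0).prod (convex_Ici 0))
  have hqU : q ∉ convexHull ℝ P + R := by
    rintro ⟨y, hy, r, ⟨hr1, hr2⟩, rfl⟩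
    have hr1 : r.1 = 0 := hr1
    have hr2 : 0 ≤ r.2 := hr2
    have := hno y hy (by simp [hr1])
    simp only [Prod.snd_add] at this
    linarith
  obtain ⟨f, u, hfq, hfU⟩ := geometric_hahn_banach_point_closed hconv hclosed hqU
  set α := f (1, 0)
  set β := f (0, 1)
  have hf : ∀ x : ℝ × ℝ, f x = α * x.1 + β * x.2 := by
    intro x
    have : x = x.1 • ((1, 0) : ℝ × ℝ) + x.2 • ((0, 1) : ℝ × ℝ) := by ext <;> simp
    conv_lhs => rw [this]
    rw [map_add, map_smul, map_smul, smul_eq_mul, smul_eq_mul, mul_comm, mul_comm x.2]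
  have hPU : ∀ x ∈ P, ∀ t : ℝ, 0 ≤ t → u < f x + β * t := by
    intro x hx t ht
    have := hfU (x + (0, t)) ⟨x, subset_convexHull ℝ P hx, (0, t), ⟨rfl, ht⟩, rfl⟩
    rw [map_add, hf (0, t)] at this
    simpa using this
  have hβ : 0 ≤ β := by
    by_contra! hβ
    obtain ⟨x, hx⟩ := hne
    have h0 := hPU x hx 0 le_rfl
    have := hPU x hx ((f x - u) / -β) (div_nonneg (by linarith) (by linarith))
    rw [mul_div_assoc', div_neg, mul_div_cancel_left₀ _ hβ.ne] at this
    linarith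
  obtain ⟨m, hm⟩ : ∃ m : ℝ, ∀ x ∈ P, m ≤ x.2 := by
    obtain ⟨m, hm⟩ := (hP.image Prod.snd).bddBelow
    exact ⟨m, fun x hx => hm ⟨x, hx, rfl⟩⟩
  -- Replacing `β` by `β + ε` rules out a vertical line. As `m` bounds the heights of `P` from
  -- below, the threshold on `P` becomes `u + ε m`; this `ε` is small enough for `q` to stay
  -- strictly on the other side.
  set ε : ℝ := (u - f q) / (|q.2 - m| + 1) with hε
  have hgap : 0 < u - f q := by linarith
  have habs : 0 < |q.2 - m| + 1 := by positivity
  have hεpos : 0 < ε := div_pos hgap habs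
  have hεq : ε * (q.2 - m) < u - f q := by
    have h1 : ε * (|q.2 - m| + 1) = u - f q := div_mul_cancel₀ _ habs.ne'
    have h2 := mul_le_mul_of_nonneg_left (le_abs_self (q.2 - m)) hεpos.le
    linarith
  have hβ' : 0 < β + ε := by linarith
  have hx : ∀ x ∈ P, (u + ε * m) / (β + ε) ≤ x.2 - (-α / (β + ε)) * x.1 := by
    intro x hx
    have h1 := hPU x hx 0 le_rfl
    have h2 := mul_le_mul_of_nonneg_left (hm x hx) hεpos.le
    rw [hf x] at h1
    rw [div_le_iff₀ hβ', sub_mul, mul_right_comm, div_mul_cancel₀ _ hβ'.ne']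
    linarith
  have h3 := convexHull_subset_halfPlane (h _ _ hx) hq
  rw [div_le_iff₀ hβ', sub_mul, mul_right_comm, div_mul_cancel₀ _ hβ'.ne'] at h3
  rw [hf q] at hεq
  linarith

/-- The lower convex hull of a finite set is determined by its supporting lines. -/
lemma lowerHull_subset (hP : P.Finite) (hQ : Q.Finite) (hPne : P.Nonempty) (hQne : Q.Nonempty)
    (h : ∀ s c : ℝ, (∀ x ∈ P, c ≤ x.2 - s * x.1) ↔ ∀ x ∈ Q, c ≤ x.2 - s * x.1) :
    lowerHull P ⊆ lowerHull Q := by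
  rintro q ⟨hq, hmin⟩
  have hPQ : ∀ {x}, x ∈ convexHull ℝ Q → ∃ y ∈ convexHull ℝ P, y.1 = x.1 ∧ y.2 ≤ x.2 :=
    fun hx => exists_below hP hPne (fun s c => (h s c).1) hx
  obtain ⟨y, hy, hy1, hy2⟩ := exists_below hQ hQne (fun s c => (h s c).2) hq
  have key : ∀ x ∈ convexHull ℝ Q, x.1 = q.1 → q.2 ≤ x.2 := by
    intro x hx hx1
    obtain ⟨z, hz, hz1, hz2⟩ := hPQ hx
    refine (hmin z.2 ?_).trans hz2
    rwa [← hx1, ← hz1]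
  have hyq : y = q := Prod.ext hy1 (le_antisymm hy2 (key y hy hy1))
  exact ⟨hyq ▸ hy, fun t ht => key _ ht rfl⟩

theorem lowerHull_eq_iff (hP : P.Finite) (hQ : Q.Finite) (hPne : P.Nonempty) (hQne : Q.Nonempty) :
    lowerHull P = lowerHull Q ↔
      ∀ s c : ℝ, (∀ x ∈ P, c ≤ x.2 - s * x.1) ↔ ∀ x ∈ Q, c ≤ x.2 - s * x.1 := by
  constructor
  · intro h s c
    rw [halfPlane_lowerHull_iff hP, halfPlane_lowerHull_iff hQ, h]
  · intro h
    exact (lowerHull_subset hP hQ hPne hQne h).antisymm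
      (lowerHull_subset hQ hP hQne hPne fun s c => (h s c).symm)

end LowerHull

/-! ### The Newton polygon through Gauss norms -/

section NewtonPolygon

variable {p : ℕ} [Fact p.Prime]

lemma gaussNorm_one_sub (h : ℂ_[p]) {d : ℕ} (hd : 0 < d) {r : ℝ} (hr : 0 < r) :
    (1 - Polynomial.C h * Polynomial.X ^ d).gaussNorm
      (IsAbsoluteValue.toAbsoluteValue (norm : ℂ_[p] → ℝ)) r = max 1 (‖h‖ * r ^ d) := by
  set v := IsAbsoluteValue.toAbsoluteValue (norm : ℂ_[p] → ℝ)
  have hv : ∀ x, v x = ‖x‖ := fun _ => rfl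
  set f : Polynomial ℂ_[p] := 1 - Polynomial.C h * Polynomial.X ^ d with hf
  have hcoeff : ∀ i, f.coeff i = if i = 0 then 1 else if i = d then -h else 0 := by
    intro i
    rw [hf, Polynomial.coeff_sub, Polynomial.coeff_C_mul, Polynomial.coeff_X_pow,
      Polynomial.coeff_one]
    by_cases h0 : i = 0
    · subst h0; simp [hd.ne]
    · by_cases hid : i = d <;> simp [h0, hid, hd.ne']
  refine le_antisymm ?_ (max_le ?_ ?_)
  · obtain ⟨i, hi⟩ := f.exists_eq_gaussNorm v r
    rw [hi, hv, hcoeff]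
    split_ifs with h0 hid
    · subst h0; simp
    · subst hid; simp
    · simp
  · have := f.le_gaussNorm v hr.le 0
    rwa [hv, hcoeff, if_pos rfl, norm_one, pow_zero, mul_one] at this
  · have := f.le_gaussNorm v hr.le d
    rwa [hv, hcoeff, if_neg hd.ne', if_pos rfl, norm_neg] at this

/-- Multiplicativity of the Gauss norm makes the supporting intercepts of Newton polygons add up
over the factors of a product. -/
lemma gaussNorm_prod {ι : Type*} (s : Finset ι) (f : ι → Polynomial ℂ_[p]) {r : ℝ} (hr : 0 < r) :
    (∏ i ∈ s, f i).gaussNorm (IsAbsoluteValue.toAbsoluteValue (norm : ℂ_[p] → ℝ)) r =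
      ∏ i ∈ s, (f i).gaussNorm (IsAbsoluteValue.toAbsoluteValue (norm : ℂ_[p] → ℝ)) r := by
  classical
  induction s using Finset.induction_on with
  | empty =>
    have := Polynomial.gaussNorm_C (IsAbsoluteValue.toAbsoluteValue (norm : ℂ_[p] → ℝ)) r 1
    simpa using this
  | insert a s ha ih =>
    rw [Finset.prod_insert ha, Finset.prod_insert ha,
      Polynomial.gaussNorm_mul (PadicComplex.isNonarchimedean p) hr, ih]

variable (p) in
/-- The points defining the Newton polygon. -/
def newtonPoints (g : PowerSeries ℂ_[p]) : Set (ℝ × ℝ) :=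
  {q | ∃ i : ℕ, PowerSeries.coeff i g ≠ 0 ∧ q = ((i : ℝ), ord p (PowerSeries.coeff i g))}

lemma newtonPoints_finite (f : Polynomial ℂ_[p]) : (newtonPoints p (f : PowerSeries ℂ_[p])).Finite := by
  refine (f.support.finite_toSet.image
    (fun i : ℕ => ((i : ℝ), ord p (f.coeff i)))).subset ?_
  rintro q ⟨i, hi, rfl⟩
  rw [Polynomial.coeff_coe] at hi ⊢
  exact ⟨i, by simpa using hi, rfl⟩

/-- The supporting lines of a Newton polygon are given by Gauss norms. -/
lemma halfPlane_newtonPoints_iff (f : Polynomial ℂ_[p]) (s c : ℝ) :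
    (∀ x ∈ newtonPoints p (f : PowerSeries ℂ_[p]), c ≤ x.2 - s * x.1) ↔
      f.gaussNorm (IsAbsoluteValue.toAbsoluteValue (norm : ℂ_[p] → ℝ)) ((p : ℝ) ^ s) ≤
        (p : ℝ) ^ (-c) := by
  have hp1 : (1 : ℝ) < p := by exact_mod_cast (Fact.out : p.Prime).one_lt
  have hp0 : (0 : ℝ) < p := zero_lt_one.trans hp1
  set v := IsAbsoluteValue.toAbsoluteValue (norm : ℂ_[p] → ℝ)
  have hv : ∀ x, v x = ‖x‖ := fun _ => rfl
  have hr : 0 < (p : ℝ) ^ s := Real.rpow_pos_of_pos hp0 s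
  have key : ∀ i, f.coeff i ≠ 0 → (c ≤ ord p (f.coeff i) - s * i ↔
      v (f.coeff i) * ((p : ℝ) ^ s) ^ i ≤ (p : ℝ) ^ (-c)) := by
    intro i hi
    have hn : ‖f.coeff i‖ = (p : ℝ) ^ (-ord p (f.coeff i)) := by
      rw [ord, neg_neg, Real.rpow_logb hp0 hp1.ne' (norm_pos_iff.2 hi)]
    rw [hv, hn, ← Real.rpow_natCast, ← Real.rpow_mul hp0.le, ← Real.rpow_add hp0,
      Real.rpow_le_rpow_left_iff hp1]
    constructor <;> intro h <;> linarith
  constructor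
  · intro h
    obtain ⟨i, hi⟩ := f.exists_eq_gaussNorm v ((p : ℝ) ^ s)
    rw [hi]
    by_cases h0 : f.coeff i = 0
    · rw [h0, hv, norm_zero, zero_mul]; positivity
    · exact (key i h0).1 (h ((i : ℝ), ord p (f.coeff i))
        ⟨i, by rwa [Polynomial.coeff_coe], by rw [Polynomial.coeff_coe]⟩)
  · rintro h x ⟨i, hi, rfl⟩
    rw [Polynomial.coeff_coe] at hi ⊢
    exact (key i hi).2 ((f.le_gaussNorm v hr.le i).trans h)

variable {ζ : ℂ_[p]} (hζ : IsPrimitiveRoot ζ p) {n : ℕ} {w : Fin n → Fin n → ℤ}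
  [NeZero (latticeIndex w)] (hcop : Nat.Coprime p (latticeIndex w))

lemma orbitPoly_coeff_zero : (orbitPoly hζ hcop).coeff 0 = 1 := by
  rw [orbitPoly, Polynomial.coeff_zero_prod]
  refine Finset.prod_eq_one fun o _ => ?_
  simp [(orbitLength_pos o).ne]

/-- At radius `p ^ s` the factor of an orbit has Gauss norm `max 1 (‖λ‖ p ^ (s d))`; taking `-log_p`
gives the minimum of 0 and the sum of `weight - s` along the orbit. -/
lemma halfPlane_orbitPoly_iff (s c : ℝ) :
    (∀ x ∈ newtonPoints p (orbitPoly hζ hcop : PowerSeries ℂ_[p]), c ≤ x.2 - s * x.1) ↔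
      c ≤ ∑ o : Orbits (frobPerm hcop), min 0 (∑ k ∈ Finset.range (orbitLength _ o),
        (fracWeight (((frobPerm hcop) ^ k) (orbitPoint _ o)) - s)) := by
  have hp1 : (1 : ℝ) < p := by exact_mod_cast (Fact.out : p.Prime).one_lt
  have hp0 : (0 : ℝ) < p := zero_lt_one.trans hp1
  have hr : 0 < (p : ℝ) ^ s := Real.rpow_pos_of_pos hp0 s
  rw [halfPlane_newtonPoints_iff, orbitPoly, gaussNorm_prod _ _ hr]
  have hfac : ∀ o : Orbits (frobPerm hcop),
      (1 - Polynomial.C (frobEigen hζ w (orbitLength _ o) (orbitPoint _ o)) *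
        Polynomial.X ^ orbitLength _ o).gaussNorm
        (IsAbsoluteValue.toAbsoluteValue (norm : ℂ_[p] → ℝ)) ((p : ℝ) ^ s) =
      (p : ℝ) ^ (-min 0 (∑ k ∈ Finset.range (orbitLength _ o),
        (fracWeight (((frobPerm hcop) ^ k) (orbitPoint _ o)) - s))) := by
    intro o
    have hd := orbitLength_pos o
    rw [gaussNorm_one_sub _ hd hr, norm_frobEigen hζ hcop hd.ne'
      ((pow_orbitPoint_eq_iff o _).2 dvd_rfl), ← Real.rpow_natCast, ← Real.rpow_mul hp0.le,
      ← Real.rpow_add hp0, Finset.sum_sub_distrib, Finset.sum_const, Finset.card_range,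
      nsmul_eq_mul, ← max_neg_neg, neg_zero, Real.monotone_rpow_of_base_ge_one hp1.le |>.map_max,
      Real.rpow_zero]
    congr 2
    ring
  rw [Finset.prod_congr rfl fun o _ => hfac o, ← Real.rpow_sum_of_pos hp0,
    Real.rpow_le_rpow_left_iff hp1, Finset.sum_neg_distrib, neg_le_neg_iff]

end NewtonPolygon

end DiagExpSum

end

noncomputable section

namespace DiagExpSum

/-! ### Lattice points of the cone -/

section ConeLattice

variable {n : ℕ} {w : Fin n → Fin n → ℤ} [NeZero (latticeIndex w)]

omit [NeZero (latticeIndex w)] in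
lemma realMatrix_mulVec (r : Fin n → ℝ) :
    ((expMatrix w).map (Int.cast : ℤ → ℝ)).mulVec r = ∑ i, r i • realExp w i := by
  funext k
  rw [Finset.sum_apply]
  simp only [Matrix.mulVec, dotProduct, Matrix.map_apply, expMatrix, Matrix.of_apply,
    Pi.smul_apply, smul_eq_mul, realExp, mul_comm]

omit [NeZero (latticeIndex w)] in
lemma det_realMatrix :
    ((expMatrix w).map (Int.cast : ℤ → ℝ)).det = ((expMatrix w).det : ℝ) := by
  have := (Int.castRingHom ℝ).map_det (expMatrix w)
  exact this.symm

lemma isUnit_det_realMatrix : IsUnit ((expMatrix w).map (Int.cast : ℤ → ℝ)).det := by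
  rw [det_realMatrix, isUnit_iff_ne_zero, Int.cast_ne_zero]
  exact Int.natAbs_ne_zero.1 (NeZero.ne (latticeIndex w))

lemma coords_sum (r : Fin n → ℝ) : coords w (∑ i, r i • realExp w i) = r := by
  rw [← realMatrix_mulVec, coords, Matrix.mulVec_mulVec,
    Matrix.nonsing_inv_mul _ isUnit_det_realMatrix, Matrix.one_mulVec]

lemma sum_coords (v : Fin n → ℝ) : ∑ i, coords w v i • realExp w i = v := by
  rw [← realMatrix_mulVec, coords, Matrix.mulVec_mulVec,
    Matrix.mul_nonsing_inv _ isUnit_det_realMatrix, Matrix.one_mulVec]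

/-- The coordinates of an integral vector have the index of the lattice as denominator. -/
lemma exists_int_coords (u : Fin n → ℤ) (j : Fin n) :
    ∃ z : ℤ, (latticeIndex w : ℝ) * coords w (fun k => (u k : ℝ)) j = z := by
  set J := (expMatrix w).map (Int.cast : ℤ → ℝ) with hJ
  have hadj : J.adjugate = (expMatrix w).adjugate.map (Int.cast : ℤ → ℝ) := by
    have := (Int.castRingHom ℝ).map_adjugate (expMatrix w)
    exact this.symm
  have hdet : J.det * coords w (fun k => (u k : ℝ)) j =
      (((expMatrix w).adjugate.mulVec u j : ℤ) : ℝ) := by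
    rw [coords, ← hJ, Matrix.inv_def, Matrix.smul_mulVec, Pi.smul_apply, smul_eq_mul, ← mul_assoc,
      Ring.mul_inverse_cancel _ isUnit_det_realMatrix, one_mul, hadj]
    simp only [Matrix.mulVec, dotProduct, Matrix.map_apply]
    push_cast
    rfl
  rw [det_realMatrix] at hdet
  rcases Int.natAbs_eq (expMatrix w).det with h | h
  · refine ⟨(expMatrix w).adjugate.mulVec u j, ?_⟩
    rw [← hdet]
    congr 1
    rw [latticeIndex]
    rw [← Int.cast_natCast, ← h]
  · refine ⟨-((expMatrix w).adjugate.mulVec u j), ?_⟩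
    rw [Int.cast_neg, ← hdet, ← neg_mul]
    congr 1
    rw [latticeIndex, h]
    simp

/-- The point of the cone whose coordinates have fractional part `b` and integral part `m`. -/
def latticePoint (b : FracPoint w) (m : Fin n → ℕ) : Fin n → ℝ :=
  ∑ j, (fracCoord b j + m j) • realExp w j

lemma coords_latticePoint (b : FracPoint w) (m : Fin n → ℕ) :
    coords w (latticePoint b m) = fun j => fracCoord b j + m j := coords_sum _

lemma weight_latticePoint (b : FracPoint w) (m : Fin n → ℕ) :
    weight w (latticePoint b m) = fracWeight b + (∑ j, m j : ℕ) := by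
  rw [weight, coords_latticePoint, Finset.sum_add_distrib, fracWeight, Nat.cast_sum]

lemma fracCoord_add_injective {b b' : FracPoint w} {m m' : Fin n → ℕ}
    (h : ∀ j, fracCoord b j + m j = fracCoord b' j + m' j) : b = b' ∧ m = m' := by
  have hm : m = m' := by
    funext j
    have h1 := congrArg Nat.floor (h j)
    rwa [Nat.floor_add_natCast (fracCoord_nonneg b j), Nat.floor_add_natCast
      (fracCoord_nonneg b' j), Nat.floor_eq_zero.2 (fracCoord_lt_one b j),
      Nat.floor_eq_zero.2 (fracCoord_lt_one b' j), zero_add, zero_add] at h1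
  refine ⟨Subtype.ext (funext fun j => ZMod.val_injective _ ?_), hm⟩
  have h1 := h j
  rw [hm, add_left_inj, fracCoord, fracCoord, div_left_inj'
    (Nat.cast_ne_zero.2 (NeZero.ne (latticeIndex w)))] at h1
  exact_mod_cast h1

lemma latticePoint_injective :
    Function.Injective (fun x : FracPoint w × (Fin n → ℕ) => latticePoint x.1 x.2) := by
  rintro ⟨b, m⟩ ⟨b', m'⟩ h
  have h1 := congrArg (coords w) h
  simp only [coords_latticePoint] at h1
  obtain ⟨rfl, rfl⟩ := fracCoord_add_injective fun j => congrFun h1 j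
  rfl

lemma latticePoint_mem (b : FracPoint w) (m : Fin n → ℕ) : latticePoint b m ∈ coneLattice w := by
  have hD : (latticeIndex w : ℝ) ≠ 0 := Nat.cast_ne_zero.2 (NeZero.ne (latticeIndex w))
  refine ⟨⟨_, fun j => add_nonneg (fracCoord_nonneg b j) (Nat.cast_nonneg _), rfl⟩, ?_⟩
  have h1 : ∀ k, (latticeIndex w : ℤ) ∣ ∑ j, ((b.1 j).val : ℤ) * w j k := fun k => by
    rw [← ZMod.intCast_zmod_eq_zero_iff_dvd]
    push_cast
    simpa using b.2 k
  choose e he using h1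
  refine ⟨fun k => e k + ∑ j, m j * w j k, funext fun k => ?_⟩
  have h2 : ∑ j, ((b.1 j).val : ℝ) * w j k = latticeIndex w * e k := by exact_mod_cast he k
  simp only [latticePoint, Finset.sum_apply, Pi.smul_apply, smul_eq_mul, realExp, add_mul,
    Finset.sum_add_distrib, fracCoord, div_mul_eq_mul_div, ← Finset.sum_div, h2]
  rw [mul_div_cancel_left₀ _ hD]
  push_cast
  rfl

lemma coords_nonneg {u : Fin n → ℝ} (hu : u ∈ cone w) (j : Fin n) : 0 ≤ coords w u j := by
  obtain ⟨r, hr, rfl⟩ := hu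
  rw [coords_sum]
  exact hr j

/-- The coordinates times `D = latticeIndex w` are natural numbers. Dividing by `D`, the remainders
give the point of the fundamental domain and the quotients the integral part. -/
lemma exists_latticePoint {u : Fin n → ℝ} (hu : u ∈ coneLattice w) :
    ∃ (b : FracPoint w) (m : Fin n → ℕ), latticePoint b m = u := by
  obtain ⟨hc, u', hu'⟩ := hu
  have hD0 : 0 < latticeIndex w := Nat.pos_of_ne_zero (NeZero.ne (latticeIndex w))
  have hD : (latticeIndex w : ℝ) ≠ 0 := Nat.cast_ne_zero.2 hD0.ne'
  have hz : ∀ j, ∃ z : ℕ, (latticeIndex w : ℝ) * coords w u j = z := by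
    intro j
    obtain ⟨z, hz⟩ := exists_int_coords (w := w) u' j
    rw [← hu'] at hz
    have h0 : (0 : ℝ) ≤ z := hz ▸ mul_nonneg (Nat.cast_nonneg _) (coords_nonneg hc j)
    obtain ⟨z', rfl⟩ := Int.eq_ofNat_of_zero_le (by exact_mod_cast h0 : 0 ≤ z)
    exact ⟨z', by rw [hz]; simp⟩
  choose z hz using hz
  let b : FracPoint w := ⟨fun j => (z j : ZMod (latticeIndex w)), fun k => by
    have h1 : ((∑ j, (z j : ℤ) * w j k : ℤ) : ℝ) = ((latticeIndex w * u' k : ℤ) : ℝ) := by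
      push_cast
      have h2 := congrFun (sum_coords (w := w) u) k
      rw [Finset.sum_apply] at h2
      rw [show (u' k : ℝ) = u k from (congrFun hu' k).symm, ← h2, Finset.mul_sum]
      refine Finset.sum_congr rfl fun j _ => ?_
      rw [← hz]
      simp only [Pi.smul_apply, smul_eq_mul, realExp]
      ring
    have h3 : ∑ j, (z j : ℤ) * w j k = latticeIndex w * u' k := by exact_mod_cast h1
    have h4 := congrArg (Int.cast : ℤ → ZMod (latticeIndex w)) h3
    push_cast at h4
    rw [h4]
    simp⟩
  refine ⟨b, fun j => z j / latticeIndex w, ?_⟩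
  rw [← sum_coords (w := w) u, latticePoint]
  refine Finset.sum_congr rfl fun j _ => ?_
  congr 1
  rw [fracCoord, ZMod.val_natCast, div_add' _ _ _ hD, div_eq_iff hD, mul_comm (coords w u j), hz]
  exact_mod_cast Nat.mod_add_div' (z j) (latticeIndex w)

lemma latticePoint_zero_mem (b : FracPoint w) : latticePoint b 0 ∈ fundDomain w := by
  refine ⟨latticePoint_mem b 0, fun i => ?_⟩
  rw [coords_latticePoint]
  simpa using ⟨fracCoord_nonneg b i, fracCoord_lt_one b i⟩

lemma exists_latticePoint_zero {u : Fin n → ℝ} (hu : u ∈ fundDomain w) :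
    ∃ b : FracPoint w, latticePoint b 0 = u := by
  obtain ⟨b, m, rfl⟩ := exists_latticePoint hu.1
  have hm : m = 0 := by
    funext j
    have h1 := (hu.2 j).2
    rw [coords_latticePoint] at h1
    have h2 := fracCoord_nonneg b j
    have h3 : (m j : ℝ) < 1 := by linarith
    exact Nat.lt_one_iff.1 (by exact_mod_cast h3)
  exact ⟨b, by rw [hm]⟩

lemma weight_latticePoint_zero (b : FracPoint w) : weight w (latticePoint b 0) = fracWeight b := by
  simp [weight_latticePoint]

lemma pAct_latticePoint_zero {p : ℕ} (hcop : Nat.Coprime p (latticeIndex w)) (b : FracPoint w) :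
    pAct p w (latticePoint b 0) = latticePoint (frobPerm hcop b) 0 := by
  rw [pAct, coords_latticePoint, latticePoint]
  refine Finset.sum_congr rfl fun j _ => ?_
  have := fract_pow_mul_fracCoord hcop 1 b j
  rw [pow_one, pow_one] at this
  simp [this]

theorem isPStable_iff {p : ℕ} (hcop : Nat.Coprime p (latticeIndex w)) :
    IsPStable p w ↔ ∀ b : FracPoint w, fracWeight b = fracWeight (frobPerm hcop b) := by
  constructor
  · intro h b
    have := h _ (latticePoint_zero_mem b)
    rwa [pAct_latticePoint_zero hcop, weight_latticePoint_zero, weight_latticePoint_zero] at this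
  · intro h u hu
    obtain ⟨b, rfl⟩ := exists_latticePoint_zero hu
    rw [pAct_latticePoint_zero hcop, weight_latticePoint_zero, weight_latticePoint_zero, h]

end ConeLattice

/-! ### Hodge numbers and the Hodge polygon -/

section HodgeNumbers

open PowerSeries

variable {n : ℕ} {w : Fin n → Fin n → ℤ} [NeZero (latticeIndex w)]

omit [NeZero (latticeIndex w)] in
lemma fracWeight_nonneg (b : FracPoint w) : 0 ≤ fracWeight b :=
  Finset.sum_nonneg fun j _ => fracCoord_nonneg b j

lemma exists_fracWeight_eq {M : ℕ} (hM : IsWeightDenominator w M) :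
    ∃ e : FracPoint w → ℕ, ∀ b, fracWeight b = e b / M := by
  have : ∀ b : FracPoint w, ∃ e : ℕ, fracWeight b = e / M := by
    intro b
    obtain ⟨z, hz⟩ := hM.2 _ (latticePoint_mem b 0)
    rw [weight_latticePoint_zero] at hz
    have hM0 : (0 : ℝ) < M := by exact_mod_cast hM.1
    have h0 : (0 : ℝ) ≤ z := by
      have := fracWeight_nonneg b
      rw [hz] at this
      simpa [hM0.ne'] using mul_nonneg this hM0.le
    obtain ⟨z', rfl⟩ := Int.eq_ofNat_of_zero_le (by exact_mod_cast h0 : 0 ≤ z)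
    exact ⟨z', by rw [hz]; simp⟩
  exact ⟨fun b => (this b).choose, fun b => (this b).choose_spec⟩

/-- The tuples of multiples of `M` with sum `N`. -/
def multipleTuples (n M N : ℕ) : Finset (Fin n →₀ ℕ) :=
  (Finset.finsuppAntidiag Finset.univ N).filter fun l => ∀ i, M ∣ l i

/-- The generating series of the multiples of `M`. -/
def multipleSeries (M : ℕ) : PowerSeries ℤ := mk fun k => if M ∣ k then 1 else 0

lemma one_sub_X_pow_mul_multipleSeries {M : ℕ} (hM : 0 < M) :
    (1 - X ^ M) * multipleSeries M = 1 := by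
  ext k
  rw [sub_mul, one_mul, map_sub, coeff_X_pow_mul', coeff_one, multipleSeries, coeff_mk]
  by_cases hk : M ≤ k
  · rw [if_pos hk, coeff_mk, if_neg (by lia : k ≠ 0)]
    have : M ∣ k - M ↔ M ∣ k := by
      conv_rhs => rw [← Nat.sub_add_cancel hk, Nat.dvd_add_self_right]
    rw [if_congr this rfl rfl, sub_self]
  · rw [if_neg hk, sub_zero]
    refine if_congr ⟨fun h => ?_, fun h => h ▸ dvd_zero M⟩ rfl rfl
    by_contra h0
    exact hk (Nat.le_of_dvd (Nat.pos_of_ne_zero h0) h)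

lemma coeff_multipleSeries_pow (M N : ℕ) :
    coeff N (multipleSeries M ^ n) = (multipleTuples n M N).card := by
  classical
  have h := coeff_prod (fun _ : Fin n => multipleSeries M) N Finset.univ
  rw [Finset.prod_const, Finset.card_univ, Fintype.card_fin] at h
  rw [h, multipleTuples, Finset.card_filter]
  push_cast
  refine Finset.sum_congr rfl fun l _ => ?_
  simp only [multipleSeries, coeff_mk]
  split_ifs with hl
  · exact Finset.prod_eq_one fun i _ => if_pos (hl i)
  · push Not at hl
    obtain ⟨i, hi⟩ := hl
    exact Finset.prod_eq_zero (Finset.mem_univ i) (if_neg hi)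

/-- Sort the lattice points by their fractional part `b`. An integral part `m` is recorded by the
tuple `M m`, whose sum must be `k - e b`. -/
lemma weightCount_natCast {M : ℕ} (hM : 0 < M) {e : FracPoint w → ℕ}
    (he : ∀ b, fracWeight b = e b / M) (k : ℕ) :
    weightCount w M k = ∑ b, if e b ≤ k then (multipleTuples n M (k - e b)).card else 0 := by
  classical
  have hM0 : (M : ℝ) ≠ 0 := Nat.cast_ne_zero.2 hM.ne'
  set s : Finset (Σ _ : FracPoint w, Fin n →₀ ℕ) := Finset.univ.sigma fun b =>
    if e b ≤ k then multipleTuples n M (k - e b) else ∅ with hs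
  set g : (Σ _ : FracPoint w, Fin n →₀ ℕ) → (Fin n → ℝ) :=
    fun x => latticePoint x.1 (fun j => x.2 j / M) with hg
  have hmem : ∀ x, x ∈ s ↔ (∀ i, M ∣ x.2 i) ∧ e x.1 + ∑ i, x.2 i = k := by
    rintro ⟨b, l⟩
    simp only [hs, Finset.mem_sigma, Finset.mem_univ, true_and]
    split_ifs with hb
    · simp only [multipleTuples, Finset.mem_filter, Finset.mem_finsuppAntidiag,
        Finset.subset_univ, and_true]
      rw [and_comm]
      refine and_congr_right fun _ => ?_
      constructor <;> intro h <;> lia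
    · simp only [Finset.notMem_empty, false_iff, not_and]
      intro _ h
      lia
  -- Being the image of a finset, the set is finite, so `Set.ncard` is a true count and not its
  -- default value 0.
  have hset : {u | u ∈ coneLattice w ∧ weight w u = ((k : ℤ) : ℝ) / M} = g '' (s : Set _) := by
    ext u
    constructor
    · rintro ⟨hu, hw⟩
      obtain ⟨b, m, rfl⟩ := exists_latticePoint hu
      rw [weight_latticePoint, he, div_add' _ _ _ hM0, div_left_inj' hM0] at hw
      refine ⟨⟨b, Finsupp.equivFunOnFinite.symm fun j => M * m j⟩, ?_, ?_⟩
      · rw [Finset.mem_coe, hmem]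
        refine ⟨fun i => by simp, ?_⟩
        simp only [Finsupp.equivFunOnFinite_symm_apply_apply, ← Finset.mul_sum]
        rw [mul_comm M]
        exact_mod_cast hw
      · simp only [hg, Finsupp.equivFunOnFinite_symm_apply_apply, Nat.mul_div_cancel_left _ hM]
    · rintro ⟨⟨b, l⟩, hx, rfl⟩
      rw [Finset.mem_coe, hmem] at hx
      obtain ⟨hdvd, hsum⟩ := hx
      refine ⟨latticePoint_mem _ _, ?_⟩
      simp only [hg]
      rw [weight_latticePoint, he, div_add' _ _ _ hM0, div_left_inj' hM0]
      have : (∑ j, l j / M) * M = ∑ j, l j := by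
        rw [Finset.sum_mul]
        exact Finset.sum_congr rfl fun j _ => Nat.div_mul_cancel (hdvd j)
      rw [← hsum, ← this]
      push_cast
      rfl
  have hinj : Set.InjOn g (s : Set _) := by
    rintro ⟨b, l⟩ hx ⟨b', l'⟩ hx' h
    rw [Finset.mem_coe, hmem] at hx hx'
    have h1 := latticePoint_injective (a₁ := (b, fun j => l j / M))
      (a₂ := (b', fun j => l' j / M)) h
    obtain ⟨rfl, h2⟩ := Prod.mk.inj h1
    have : l = l' := by
      ext j
      rw [← Nat.div_mul_cancel (hx.1 j), ← Nat.div_mul_cancel (hx'.1 j)]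
      exact congrArg (· * M) (congrFun h2 j)
    rw [this]
  rw [weightCount, hset, hinj.ncard_image, Set.ncard_coe_finset, hs,
    Finset.card_sigma]
  refine Finset.sum_congr rfl fun b _ => ?_
  split_ifs <;> simp

lemma weightCount_of_neg {M : ℕ} (hM : 0 < M) {l : ℤ} (hl : l < 0) : weightCount w M l = 0 := by
  have hM0 : (0 : ℝ) < M := by exact_mod_cast hM
  have : {u | u ∈ coneLattice w ∧ weight w u = (l : ℝ) / (M : ℝ)} = ∅ := by
    refine Set.eq_empty_of_forall_notMem ?_
    rintro u ⟨hu, hw⟩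
    have h1 : 0 ≤ weight w u := Finset.sum_nonneg fun j _ => coords_nonneg hu.1 j
    rw [hw] at h1
    have h2 : (0 : ℝ) ≤ l := by simpa [hM0.ne'] using mul_nonneg h1 hM0.le
    exact absurd (by exact_mod_cast h2 : 0 ≤ l) (not_le.2 hl)
  rw [weightCount, this, Set.ncard_empty]

/-- The alternating sum defining `H` is multiplication of the generating series of `W` by `(1 - X ^
M) ^ n`. This cancels the contribution of the integral parts and leaves `∑ X ^ (e b)`. -/
theorem hodgeNumber_eq {M : ℕ} (hM : 0 < M) {e : FracPoint w → ℕ}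
    (he : ∀ b, fracWeight b = e b / M) (k : ℕ) :
    hodgeNumber w M k = (Finset.univ.filter fun b => e b = k).card := by
  classical
  set G : PowerSeries ℤ := mk fun k => (weightCount w M (k : ℤ) : ℤ) with hG
  have hGeq : G = (∑ b, X ^ e b) * multipleSeries M ^ n := by
    ext k
    rw [hG, coeff_mk, weightCount_natCast hM he, Finset.sum_mul, map_sum]
    push_cast
    refine Finset.sum_congr rfl fun b _ => ?_
    rw [coeff_X_pow_mul', coeff_multipleSeries_pow]
  have h1 : (1 - X ^ M) ^ n * G = ∑ b, X ^ e b := by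
    rw [hGeq, mul_left_comm, ← mul_pow, one_sub_X_pow_mul_multipleSeries hM, one_pow, mul_one]
  have h2 : coeff k ((1 - X ^ M) ^ n * G) = hodgeNumber w M k := by
    have hexp : (1 - X ^ M : PowerSeries ℤ) ^ n =
        ∑ l ∈ Finset.range (n + 1), C ((-1) ^ l * (n.choose l : ℤ)) * X ^ (l * M) := by
      rw [sub_eq_add_neg, add_comm, add_pow]
      refine Finset.sum_congr rfl fun l _ => ?_
      rw [one_pow, mul_one, neg_pow, ← pow_mul, mul_comm M l]
      simp only [map_mul, map_pow, map_neg, map_one, map_natCast]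
      ring
    rw [hexp, Finset.sum_mul, map_sum, hodgeNumber]
    refine Finset.sum_congr rfl fun l _ => ?_
    rw [mul_assoc, coeff_C_mul, coeff_X_pow_mul']
    congr 1
    split_ifs with hl
    · rw [hG, coeff_mk, Nat.cast_sub hl, Nat.cast_mul]
    · rw [weightCount_of_neg hM, Nat.cast_zero]
      have : (k : ℤ) < ((l * M : ℕ) : ℤ) := by exact_mod_cast not_le.1 hl
      push_cast at this
      linarith
  rw [← h2, h1, map_sum, Finset.card_filter]
  push_cast
  refine Finset.sum_congr rfl fun b _ => ?_
  rw [coeff_X_pow]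
  exact if_congr eq_comm rfl rfl

/-- The points defining the Hodge polygon. -/
def hodgePoints (w : Fin n → Fin n → ℤ) (M : ℕ) : Set (ℝ × ℝ) :=
  {(0, 0)} ∪ {q | ∃ m : ℕ,
    q = (∑ k ∈ Finset.range (m + 1), (hodgeNumber w M k : ℝ),
      (1 / (M : ℝ)) * ∑ k ∈ Finset.range (m + 1), (k : ℝ) * (hodgeNumber w M k : ℝ))}

lemma sum_mul_hodgeNumber {M : ℕ} (hM : 0 < M) {e : FracPoint w → ℕ}
    (he : ∀ b, fracWeight b = e b / M) (m : ℕ) (F : ℕ → ℝ) :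
    ∑ k ∈ Finset.range (m + 1), F k * (hodgeNumber w M k : ℝ) =
      ∑ b, if e b ≤ m then F (e b) else 0 := by
  classical
  rw [← Finset.sum_filter, ← Finset.sum_fiberwise_of_maps_to (t := Finset.range (m + 1)) (g := e)]
  · refine Finset.sum_congr rfl fun k hk => ?_
    rw [Finset.mem_range] at hk
    rw [hodgeNumber_eq hM he, Finset.filter_filter]
    have : (Finset.univ.filter fun b => e b ≤ m ∧ e b = k) =
        Finset.univ.filter fun b => e b = k := by
      ext b; simp; lia
    rw [this, Finset.sum_congr rfl (g := fun _ => F k)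
      (fun b hb => by rw [(Finset.mem_filter.1 hb).2])]
    simp [mul_comm]
  · intro b hb
    exact Finset.mem_range.2 (Nat.lt_succ_of_le (Finset.mem_filter.1 hb).2)

/-- The partial sums are constant once `m` exceeds all `e b`; the sum `K` of the `e b` is a crude
bound for them. -/
lemma hodgePoints_finite {M : ℕ} (hM : 0 < M) {e : FracPoint w → ℕ}
    (he : ∀ b, fracWeight b = e b / M) : (hodgePoints w M).Finite := by
  classical
  refine (Set.finite_singleton _).union ?_
  set K := ∑ b, e b
  have hK : ∀ b, e b ≤ K := fun b => Finset.single_le_sum (fun _ _ => Nat.zero_le _)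
    (Finset.mem_univ b)
  refine ((Finset.range (K + 1)).finite_toSet.image fun m : ℕ =>
    ((∑ k ∈ Finset.range (m + 1), (hodgeNumber w M k : ℝ),
      (1 / (M : ℝ)) * ∑ k ∈ Finset.range (m + 1), (k : ℝ) * (hodgeNumber w M k : ℝ)) :
        ℝ × ℝ)).subset ?_
  rintro q ⟨m, rfl⟩
  refine ⟨min m K, by simp, ?_⟩
  have h := fun m => sum_mul_hodgeNumber hM he m fun _ => 1
  simp only [one_mul] at h
  have hmin : ∀ b, e b ≤ min m K ↔ e b ≤ m := fun b => by have := hK b; lia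
  simp only [h, sum_mul_hodgeNumber hM he, hmin]

/-- The supporting lines of the Hodge polygon. -/
lemma halfPlane_hodgePoints_iff {M : ℕ} (hM : 0 < M) {e : FracPoint w → ℕ}
    (he : ∀ b, fracWeight b = e b / M) (s c : ℝ) :
    (∀ x ∈ hodgePoints w M, c ≤ x.2 - s * x.1) ↔
      c ≤ ∑ b : FracPoint w, min 0 (fracWeight b - s) := by
  have hM0 : (0 : ℝ) < M := by exact_mod_cast hM
  have hval : ∀ m : ℕ, (1 / (M : ℝ)) * ∑ k ∈ Finset.range (m + 1), (k : ℝ) *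
      (hodgeNumber w M k : ℝ) - s * ∑ k ∈ Finset.range (m + 1), (hodgeNumber w M k : ℝ) =
      ∑ b : FracPoint w, if e b ≤ m then fracWeight b - s else 0 := by
    intro m
    have h1 := sum_mul_hodgeNumber hM he m fun k => (k : ℝ) / M - s
    simp only [← he] at h1
    rw [← h1, Finset.mul_sum, Finset.mul_sum, ← Finset.sum_sub_distrib]
    refine Finset.sum_congr rfl fun k _ => ?_
    field_simp
  constructor
  · intro h
    -- For `s < 0` no weight is at most `s`, and the extreme vertex is `(0, 0)`. For `s ≥ 0` it is
    -- the one with `m = ⌊s M⌋`, which collects exactly the weights at most `s`.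
    by_cases hs : s < 0
    · have h0 := h (0, 0) (Or.inl rfl)
      rw [Finset.sum_eq_zero]
      · simpa using h0
      · intro b _
        have := fracWeight_nonneg b
        exact min_eq_left (by linarith)
    · have hs : 0 ≤ s := not_lt.1 hs
      have h0 := h _ (Or.inr ⟨⌊s * M⌋₊, rfl⟩)
      simp only at h0
      rw [hval] at h0
      refine h0.trans (Finset.sum_le_sum fun b _ => ?_)
      have hiff : e b ≤ ⌊s * M⌋₊ ↔ fracWeight b ≤ s := by
        rw [Nat.le_floor_iff (mul_nonneg hs hM0.le), he, div_le_iff₀ hM0]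
      split_ifs with hb
      · exact le_min (by have := hiff.1 hb; linarith) le_rfl
      · exact le_min le_rfl (by have := not_le.1 (fun h => hb (hiff.2 h)); linarith)
  · rintro h x (rfl | ⟨m, rfl⟩)
    · simp only [mul_zero, sub_zero]
      exact h.trans (Finset.sum_nonpos fun b _ => min_le_left _ _)
    · simp only
      rw [hval]
      refine h.trans (Finset.sum_le_sum fun b _ => ?_)
      split_ifs
      · exact min_le_right _ _
      · exact min_le_left _ _

end HodgeNumbers

end DiagExpSum

end

noncomputable section

namespace DiagExpSum

/-! ### Comparison of the two polygons -/

section Comparison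

variable {B : Type*} [Fintype B] {T : Equiv.Perm B}

lemma sum_min_le_min_sum (d : ℕ) (x : ℕ → ℝ) :
    ∑ k ∈ Finset.range d, min 0 (x k) ≤ min 0 (∑ k ∈ Finset.range d, x k) :=
  le_min (Finset.sum_nonpos fun _ _ => min_le_left _ _)
    (Finset.sum_le_sum fun _ _ => min_le_right _ _)

/-- The polygon of the averages along the orbits of a permutation agrees with the polygon of the
weights exactly when the weights are constant along the orbits. -/
theorem sum_min_orbits_eq_iff (f : B → ℝ) :
    (∀ s : ℝ, ∑ o : Orbits T, min 0 (∑ k ∈ Finset.range (orbitLength T o),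
      (f ((T ^ k) (orbitPoint T o)) - s)) = ∑ b, min 0 (f b - s)) ↔ ∀ b, f b = f (T b) := by
  constructor
  · intro h
    have hconst : ∀ (o : Orbits T), ∃ a, ∀ k < orbitLength T o,
        f ((T ^ k) (orbitPoint T o)) = a := by
      intro o
      have hd : (orbitLength T o : ℝ) ≠ 0 := Nat.cast_ne_zero.2 (orbitLength_pos o).ne'
      -- Testing at the average `a` of the orbit makes its Newton term 0. The inequality between the
      -- two sums holds orbit by orbit, so equality forces every `f - a` on this orbit to be
      -- nonnegative; as they sum to 0, they all vanish.
      set a : ℝ := (∑ k ∈ Finset.range (orbitLength T o), f ((T ^ k) (orbitPoint T o))) /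
        orbitLength T o with ha
      have hsum : ∑ k ∈ Finset.range (orbitLength T o), (f ((T ^ k) (orbitPoint T o)) - a) = 0 := by
        rw [Finset.sum_sub_distrib, Finset.sum_const, Finset.card_range, nsmul_eq_mul, ha,
          mul_div_cancel₀ _ hd, sub_self]
      have h1 := h a
      rw [sum_orbits (T := T), eq_comm,
        Finset.sum_eq_sum_iff_of_le fun o _ => sum_min_le_min_sum _ _] at h1
      have h2 := h1 o (Finset.mem_univ o)
      rw [hsum, min_self, Finset.sum_eq_zero_iff_of_nonpos fun _ _ => min_le_left _ _] at h2
      have h3 : ∀ k ∈ Finset.range (orbitLength T o), 0 ≤ f ((T ^ k) (orbitPoint T o)) - a :=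
        fun k hk => min_eq_left_iff.1 (h2 k hk)
      rw [Finset.sum_eq_zero_iff_of_nonneg h3] at hsum
      exact ⟨a, fun k hk => sub_eq_zero.1 (hsum k (Finset.mem_range.2 hk))⟩
    have hall : ∀ (o : Orbits T), ∃ a, ∀ k, f ((T ^ k) (orbitPoint T o)) = a := by
      intro o
      obtain ⟨a, ha⟩ := hconst o
      refine ⟨a, fun k => ?_⟩
      rw [← ha _ (Nat.mod_lt k (orbitLength_pos o)), perm_pow_apply_eq_iterate,
        perm_pow_apply_eq_iterate, orbitLength, Function.iterate_mod_minimalPeriod_eq]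
    intro b
    obtain ⟨o, k, -, rfl⟩ := exists_orbitPoint (T := T) b
    obtain ⟨a, ha⟩ := hall o
    rw [← Equiv.Perm.mul_apply, ← pow_succ', ha, ha]
  · intro h s
    rw [sum_orbits (T := T)]
    refine Finset.sum_congr rfl fun o _ => ?_
    have hk : ∀ k, f ((T ^ k) (orbitPoint T o)) = f (orbitPoint T o) := by
      intro k
      induction k with
      | zero => simp
      | succ k ih => rw [pow_succ', Equiv.Perm.mul_apply, ← h, ih]
    simp only [hk, Finset.sum_const, Finset.card_range, nsmul_eq_mul]
    rw [mul_min_of_nonneg _ _ (Nat.cast_nonneg _), mul_zero]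

end Comparison

theorem newtonPolygon_eq_hodgePolygon_iff (p : ℕ) [Fact p.Prime] (ζ : ℂ_[p]) (hζ : IsPrimitiveRoot ζ p)
    (n : ℕ) (w : Fin n → Fin n → ℤ)
    (hJ : IsCoprime (p : ℤ) (expMatrix w).det)
    (M : ℕ) (hM : IsWeightDenominator w M) :
    newtonPolygon p
        (LFunctionSigned p ζ (diagPoly p w)) =
      hodgePolygon w M ↔
    IsPStable p w := by
  have hcop : Nat.Coprime p (latticeIndex w) := by
    rw [Int.isCoprime_iff_gcd_eq_one] at hJ
    exact hJ
  have hne : NeZero (latticeIndex w) := ⟨fun h => by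
    rw [h, Nat.coprime_zero_right] at hcop
    exact (Fact.out : p.Prime).ne_one hcop⟩
  obtain ⟨e, he⟩ := exists_fracWeight_eq hM
  rw [isPStable_iff hcop, ← sum_min_orbits_eq_iff, LFunctionSigned_eq_orbitPoly hζ hcop]
  change lowerHull (newtonPoints p _) = lowerHull (hodgePoints w M) ↔ _
  rw [lowerHull_eq_iff (newtonPoints_finite _) (hodgePoints_finite hM.1 he)
    ⟨_, 0, by rw [Polynomial.coeff_coe, orbitPoly_coeff_zero]; exact one_ne_zero, rfl⟩
    ⟨_, Or.inl rfl⟩]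
  refine forall_congr' fun s => ?_
  simp only [halfPlane_orbitPoly_iff, halfPlane_hodgePoints_iff hM.1 he]
  -- For fixed slope, the admissible intercepts form a closed lower ray on each side; the rays agree
  -- exactly when their endpoints do.
  exact ⟨fun h => eq_of_forall_le_iff h, fun h c => by rw [h]⟩

end DiagExpSum

end

theorem mainTheorem1 (p : ℕ) [Fact p.Prime] (ζ : ℂ_[p]) (hζ : IsPrimitiveRoot ζ p)
    (n : ℕ) (w : Fin n → Fin n → ℤ)
    (hJ : IsCoprime (p : ℤ) (DiagExpSum.expMatrix w).det)
    (M : ℕ) (hM : DiagExpSum.IsWeightDenominator w M) :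
    DiagExpSum.newtonPolygon p
        (DiagExpSum.LFunctionSigned p ζ (DiagExpSum.diagPoly p w)) =
      DiagExpSum.hodgePolygon w M ↔
    DiagExpSum.IsPStable p w :=
  DiagExpSum.newtonPolygon_eq_hodgePolygon_iff p ζ hζ n w hJ M hM
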